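/- Setting. Let $d,p\ge 0$ be integers and let $\bar g,\bar g_2,\bar l,\bar l_1,\bar l_2,c_0,c_s>0$ and $\bar c\in\mathbb R$ be constants. Let $g:\mathbb R^d\times\mathbb R^p\to\mathbb R^d$ and $l:\mathbb R^d\times\mathbb R^p\to\mathbb R$ satisfy: (A1) $g(x,a)=g_1(x)+c^\top a$ with $g_1\in C^2$ and a matrix $c\in\mathbb R^{p\times d}$ of operator norm $\bar c$, and for all $x,a$: $\|g(x,a)\|\le\bar g(1+\|x\|+\|a\|)$, $\|D_xg(x,a)\|\le\bar g$, $\sum_{i=1}^d\|D_x(\partial_{x_i}g(x,a))\|\le\bar g_2/(1+\|x\|)$. (A2) $l\in C^2$, $l(x,\cdot)$ is strictly convex for every $x$, and for all $x,x',a,a'$: $|l(x,a)|\le\bar l(1+\|x\|^2+\|a\|^2)$; $|l(x,a)-l(x',a')|\le\bar l\,(1+\max(\|x\|,\|x'\|)+\max(\|a\|,\|a'\|))(\|x-x'\|+\|a-a'\|)$; $\|\nabla_al(x,a)\|\ge\bar l_1\|a\|-c_0$; $\|(\nabla_a\nabla_a^\top)l(x,a)v\|\ge c_s\|v\|$ for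 all $v\in\mathbb R^p$; and $\nabla_x\nabla_a^\top l$, $\nabla_a\nabla_x^\top l$, $\nabla_x\nabla_x^\top l$ have operator norm at most $\bar l_2$. For $\rho\in\mathbb R$, a *classical solution of the value-gradient system* is a pair $(\hat\lambda,\hat a)$ with $\hat\lambda\in C^1(\mathbb R^d;\mathbb R^d)$ and, for all $x$, $$\rho\hat\lambda(x)=D^\top\hat\lambda(x)\,g(x,\hat a(x))+D_x^\top g(x,\hat a(x))\,\hat\lambda(x)+\nabla_xl(x,\hat a(x)),\qquad \hat a(x)\in\operatorname*{argmin}_{a\in\mathbb R^p}\,[g(x,a)\cdot\hat\lambda(x)+l(x,a)].$$ *PI-lambda iterates* (of growth degree at most $m$) are functions $\lambda^{(k)}:\mathbb R^d\to\mathbb R^d$, $a^{(k)}:\mathbb R^d\to\mathbb R^p$, $k\ge0$, such that for every $k\ge 0$: $\lambda^{(k+1)}$ is $C^1$, $\|\lambda^{(k+1)}(x)\|\le M_k(1+\|x\|^m)$ for some constant $M_k$, and for all $x$ $$\rho\lambda^{(k+1)}(x)-D\lambda^{(k+1)}(x)\,g(x,a^{(k)}(x))=D_x^\top g(x,a^{(k)}(x))\,\lambda^{(k)}(x)+\nabla_xl(x,a^{(k)}(x)),$$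 $$a^{(k+1)}(x)\in\operatorname*{argmin}_{a\in\mathbb R^p}\,[g(x,a)\cdot\lambda^{(k+1)}(x)+l(x,a)].$$ Write $\|u\|_\alpha^2=\int_{\mathbb R^d}\|u(x)\|^2(1+\|x\|^2)^{-2\alpha}\,dx\in[0,\infty]$, and say $u\in L^2_\alpha$ if this is finite. Claim. Let $\alpha>1$, $K\in\mathbb R$ and $m\in\mathbb N$. There is $\rho_2$, depending only on $d,p,\alpha,K,m$ and the constants above, such that the following holds for every $\rho>\rho_2$, all $g,l$ satisfying (A1)–(A2) and all PI-lambda iterates of growth degree at most $m$ whose initial pair is differentiable with $$\|\lambda^{(0)}(x)\|,\ \|a^{(0)}(x)\|\le K(1+\|x\|),\qquad \|D\lambda^{(0)}(x)\|,\ \|Da^{(0)}(x)\|\le K\qquad\text{for all }x,$$ provided that $4\alpha>d+2$ (so that functions of linear growth lie in $L^2_\alpha$) or, more generally, that $\lambda^{(1)}-\lambda^{(0)}$ and $a^{(1)}-a^{(0)}$ lie in $L^2_\alpha$. 1. There are a measurable $\lambda:\mathbb R^d\to\mathbb R^d$ with $\|\lambda^{(k)}-\lambda\|_\alpha\to0$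 (and $\lambda\in L^2_\alpha$ if $\lambda^{(0)}\in L^2_\alpha$) and a map $a$ with $a(x)\in\operatorname{argmin}_b[g(x,b)\cdot\lambda(x)+l(x,b)]$ for all $x$, such that $\lambda$ has a locally integrable weak Jacobi matrix $D\lambda$ and, for every $\phi\in C_c^\infty(\mathbb R^d)$, $$\int\frac{\rho\lambda\,\phi}{(1+\|x\|^2)^{2\alpha}}dx=\int\frac{D\lambda\;g(x,a)\,\phi}{(1+\|x\|^2)^{2\alpha}}dx+\int\frac{D_x^\top g(x,a)\,\lambda\,\phi}{(1+\|x\|^2)^{2\alpha}}dx+\int\frac{\nabla_xl(x,a)\,\phi}{(1+\|x\|^2)^{2\alpha}}dx,$$ where all four integrals converge absolutely. 2. If $(\hat\lambda,\hat a)$ is a classical solution of the value-gradient system with $\|\hat\lambda(x)\|\le K(1+\|x\|)$ for all $x$, then $\|\lambda^{(k)}-\hat\lambda\|_\alpha\to0$; and the limit $\hat\lambda$ with its control $\hat a$ satisfies the identity of part 1 with $D\lambda$ replaced by $D^\top\hat\lambda$ (and $\lambda,a$ by $\hat\lambda,\hat a$), for every $\phi\in C_c^\infty(\mathbb R^d)$.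 -/

import Mathlib

open scoped ContDiff Gradient ENNReal
open MeasureTheory Filter Topology

namespace PILambda

/-- Euclidean space `ℝⁿ`. -/
abbrev E (n : ℕ) : Type := EuclideanSpace ℝ (Fin n)

/-- The constants of the standing assumptions (`cb` is the norm of the matrix `c`). -/
structure Constants where
  gb : ℝ
  g2 : ℝ
  lb : ℝ
  l1 : ℝ
  l2 : ℝ
  c0 : ℝ
  cs : ℝ
  cb : ℝ
  gb_pos : 0 < gb
  g2_pos : 0 < g2
  lb_pos : 0 < lb
  l1_pos : 0 < l1
  l2_pos : 0 < l2
  c0_pos : 0 < c0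
  cs_pos : 0 < cs

section
variable {d p : ℕ}

/-- `D_x g (x, a)`, the Jacobi matrix in the state variable. -/
noncomputable def Dx (g : E d → E p → E d) (x : E d) (a : E p) : E d →L[ℝ] E d :=
  fderiv ℝ (fun y => g y a) x

/-- `∇_x l (x, a)`. -/
noncomputable def gradX (l : E d → E p → ℝ) (x : E d) (a : E p) : E d :=
  gradient (fun y => l y a) x

/-- `∇_a l (x, a)`. -/
noncomputable def gradA (l : E d → E p → ℝ) (x : E d) (a : E p) : E p :=
  gradient (fun b => l x b) a

/-- Assumption A1 on the dynamics: `g (x, a) = g₁ x + cᵀ a`, with the growth and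
derivative bounds. The matrix `c` is the linear map `ℝᵈ → ℝᵖ`, and `cᵀ` its adjoint. -/
structure AssumptionDynamics (C : Constants) (g : E d → E p → E d) : Prop where
  affine : ∃ (g₁ : E d → E d) (c : E d →L[ℝ] E p), ContDiff ℝ 2 g₁ ∧ ‖c‖ = C.cb ∧
    ∀ x a, g x a = g₁ x + ContinuousLinearMap.adjoint c a
  growth : ∀ x a, ‖g x a‖ ≤ C.gb * (1 + ‖x‖ + ‖a‖)
  deriv_le : ∀ x a, ‖Dx g x a‖ ≤ C.gb
  deriv2_le : ∀ x a,
    ∑ i : Fin d, ‖fderiv ℝ (fun y => Dx g y a (EuclideanSpace.single i (1 : ℝ))) x‖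
      ≤ C.g2 / (1 + ‖x‖)

/-- Assumption A2 on the running cost. -/
structure AssumptionCost (C : Constants) (l : E d → E p → ℝ) : Prop where
  smooth : ContDiff ℝ 2 (fun z : E d × E p => l z.1 z.2)
  strictConvex : ∀ x, StrictConvexOn ℝ Set.univ (fun a => l x a)
  growth : ∀ x a, |l x a| ≤ C.lb * (1 + ‖x‖ ^ 2 + ‖a‖ ^ 2)
  lipschitz : ∀ x x' a a', |l x a - l x' a'| ≤
    C.lb * ((1 + max ‖x‖ ‖x'‖ + max ‖a‖ ‖a'‖) * (‖x - x'‖ + ‖a - a'‖))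
  gradA_ge : ∀ x a, C.l1 * ‖a‖ - C.c0 ≤ ‖gradA l x a‖
  /- the Hessian in `a` is bounded below by `cs` as an operator -/
  hessAA_ge : ∀ x a v, C.cs * ‖v‖ ≤ ‖fderiv ℝ (fun b => gradA l x b) a v‖
  hessXA_le : ∀ x a, ‖fderiv ℝ (fun b => gradX l x b) a‖ ≤ C.l2
  hessAX_le : ∀ x a, ‖fderiv ℝ (fun y => gradA l y a) x‖ ≤ C.l2
  hessXX_le : ∀ x a, ‖fderiv ℝ (fun y => gradX l y a) x‖ ≤ C.l2

/-- The Hamiltonian `H (x, q, a) = g (x, a) · q + l (x, a)`. -/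
noncomputable def Ham (g : E d → E p → E d) (l : E d → E p → ℝ) (x q : E d) (a : E p) : ℝ :=
  inner ℝ (g x a) q + l x a

/-- `a x` minimizes the Hamiltonian `H (x, lam x, ·)` over `ℝᵖ`, for every `x`. -/
def IsGreedy (g : E d → E p → E d) (l : E d → E p → ℝ)
    (lam : E d → E d) (a : E d → E p) : Prop :=
  ∀ x b, Ham g l x (lam x) (a x) ≤ Ham g l x (lam x) b

/-- A classical solution of the value-gradient system
`ρ λ = (Dλ)ᵀ g (x, a) + (D_x g (x, a))ᵀ λ + ∇_x l (x, a)`, coupled with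
`a x ∈ argmin_b [g (x, b) · λ x + l (x, b)]`. -/
structure IsClassicalSolution (ρ : ℝ) (g : E d → E p → E d) (l : E d → E p → ℝ)
    (lam : E d → E d) (a : E d → E p) : Prop where
  smooth : ContDiff ℝ 1 lam
  greedy : IsGreedy g l lam a
  pde : ∀ x, ρ • lam x =
    ContinuousLinearMap.adjoint (fderiv ℝ lam x) (g x (a x))
      + ContinuousLinearMap.adjoint (Dx g x (a x)) (lam x) + gradX l x (a x)

/-- The pairs `(lam k, a k)` are iterates of PI-lambda: `lam (k + 1)` is a classical solution,
of polynomial growth of degree at most `m`, of the linear system with policy `a k`, and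
`a (k + 1)` is the greedy policy of `lam (k + 1)`. -/
structure IsPILambda (ρ : ℝ) (g : E d → E p → E d) (l : E d → E p → ℝ) (m : ℕ)
    (lam : ℕ → E d → E d) (a : ℕ → E d → E p) : Prop where
  smooth : ∀ k, ContDiff ℝ 1 (lam (k + 1))
  growth : ∀ k, ∃ M : ℝ, ∀ x, ‖lam (k + 1) x‖ ≤ M * (1 + ‖x‖ ^ m)
  pde : ∀ k x, ρ • lam (k + 1) x - fderiv ℝ (lam (k + 1)) x (g x (a k x)) =
    ContinuousLinearMap.adjoint (Dx g x (a k x)) (lam k x) + gradX l x (a k x)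
  greedy : ∀ k, IsGreedy g l (lam (k + 1)) (a (k + 1))

/-- A differentiable map with `‖u x‖ ≤ K (1 + ‖x‖)` and `‖Du x‖ ≤ K`. -/
structure LinearBounds {n : ℕ} (K : ℝ) (u : E d → E n) : Prop where
  differentiable : Differentiable ℝ u
  growth : ∀ x, ‖u x‖ ≤ K * (1 + ‖x‖)
  deriv_le : ∀ x, ‖fderiv ℝ u x‖ ≤ K

/-- The weight `(1 + ‖x‖²) ^ (-2α)`. -/
noncomputable def weight (α : ℝ) (x : E d) : ℝ := ((1 + ‖x‖ ^ 2) ^ (2 * α))⁻¹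

/-- The squared `L²_α` norm `∫ ‖u x‖² / (1 + ‖x‖²) ^ (2α) dx`, with values in `[0, ∞]`. -/
noncomputable def sqNorm {n : ℕ} (α : ℝ) (u : E d → E n) : ℝ≥0∞ :=
  ∫⁻ x, ENNReal.ofReal (‖u x‖ ^ 2 * weight α x)

/-- `G` is the weak (distributional) Jacobi matrix of `u`. -/
structure IsWeakJacobian (u : E d → E d) (G : E d → E d →L[ℝ] E d) : Prop where
  locInt : LocallyIntegrable u
  locInt_jac : LocallyIntegrable G
  byParts : ∀ φ : E d → ℝ, ContDiff ℝ ∞ φ → HasCompactSupport φ → ∀ v : E d,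
    ∫ x, fderiv ℝ φ x v • u x = - ∫ x, φ x • G x v

/-- `ρ lam = J g (x, a) + (D_x g (x, a))ᵀ lam + ∇_x l (x, a)` holds when integrated against every
`φ / (1 + ‖x‖²) ^ (2α)`, `φ` a smooth compactly supported test function; all four
integrals exist. -/
def WeakIdentity (ρ α : ℝ) (g : E d → E p → E d) (l : E d → E p → ℝ)
    (lam : E d → E d) (a : E d → E p) (J : E d → E d →L[ℝ] E d) : Prop :=
  ∀ φ : E d → ℝ, ContDiff ℝ ∞ φ → HasCompactSupport φ →
    Integrable (fun x => (φ x * weight α x) • (ρ • lam x)) ∧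
    Integrable (fun x => (φ x * weight α x) • J x (g x (a x))) ∧
    Integrable (fun x => (φ x * weight α x) •
      ContinuousLinearMap.adjoint (Dx g x (a x)) (lam x)) ∧
    Integrable (fun x => (φ x * weight α x) • gradX l x (a x)) ∧
    ∫ x, (φ x * weight α x) • (ρ • lam x) =
      (∫ x, (φ x * weight α x) • J x (g x (a x)))
      + (∫ x, (φ x * weight α x) • ContinuousLinearMap.adjoint (Dx g x (a x)) (lam x))
      + ∫ x, (φ x * weight α x) • gradX l x (a x)

end

end PILambda

namespace PILambda

/-! Each step solves a linear transport equation `ρ v = Dv b + F`, and a large discount rate `ρ`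
dominates the growth and the stretching of the flow `b`. Weighted maximum principles
(`norm_le_of_transport`, and `norm_sub_le_of_transport` by doubling of variables) bound the growth
and the Lipschitz constant of `v` by those of `F`, divided by `ρ` minus a rate of the flow. Greedy
policies inherit such bounds from the first-order condition `∇_a l = -c λ` and the uniform convexity
of `l` in `a`. So for large `ρ` one fixed set of bounds is reproduced at every step
(`IsPILambda.uniformBounds`).

Given these bounds, the difference of two consecutive iterates again solves a transport equation.
Once both policies involved are greedy, its right-hand side is at most a constant times the previous
difference. The maximum principle then contracts by 1/2 in the supremum norm weighted by `1 + ‖x‖`,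
which gives a pointwise limit, and the energy estimate `sqNorm_le_of_transport` gives the same
factor in `L²_α`. Hence the pointwise limit is also the `L²_α` limit
(`tendsto_sqNorm_of_contraction`).

The limit is Lipschitz, so its almost everywhere derivative is a weak Jacobi matrix. The gradients
of the iterates need not converge, but their derivatives along the limiting drift do, which suffices
for the limit equation (`transport_of_tendsto`).

For a classical solution, the envelope theorem makes `ρ λ` a gradient. Its Jacobi matrix is
therefore symmetric, the transposed system is the fixed-point equation of the iteration, and the
contraction applies to the distance between the solution and the iterates. -/

/-! ### Maximum principles for the transport equation -/

/-- Weighted maximum principle for the linear transport equation `ρ v = Dv β + F`. -/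
theorem sq_norm_le_of_transport {Z V : Type*} [NormedAddCommGroup Z] [NormedSpace ℝ Z]
    [NormedAddCommGroup V] [InnerProductSpace ℝ V]
    {v : Z → V} (hv : Differentiable ℝ v) {ψ : Z → ℝ} (hψ : Differentiable ℝ ψ)
    (hpos : ∀ z, 0 < ψ z) {β : Z → Z} {F : Z → V} {ρ κ M : ℝ} (hρ : κ < ρ)
    (pde : ∀ z, ρ • v z = fderiv ℝ v z (β z) + F z)
    (hD : ∀ z, fderiv ℝ ψ z (β z) ≤ 2 * κ * ψ z)
    (hF : ∀ z, ‖F z‖ ^ 2 ≤ M * ψ z)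
    (h0 : Tendsto (fun z => ‖v z‖ ^ 2 / ψ z) (cocompact Z) (𝓝 0)) (z : Z) :
    (ρ - κ) ^ 2 * ‖v z‖ ^ 2 ≤ M * ψ z := by
  by_contra! hz
  have hρκ : 0 < ρ - κ := sub_pos.2 hρ
  have hMz : 0 ≤ M * ψ z := (sq_nonneg _).trans (hF z)
  have hvz : 0 < ‖v z‖ ^ 2 := by
    by_contra! h
    have : ‖v z‖ ^ 2 = 0 := le_antisymm h (sq_nonneg _)
    rw [this, mul_zero] at hz
    exact absurd hz (not_lt.2 hMz)
  have hwz : 0 < ‖v z‖ ^ 2 / ψ z := div_pos hvz (hpos z)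
  have hcont : Continuous fun z => ‖v z‖ ^ 2 / ψ z :=
    (hv.continuous.norm.pow 2).div hψ.continuous fun z => (hpos z).ne'
  -- The quotient is positive at `z` and tends to 0 at infinity, so it attains its maximum.
  obtain ⟨y, hy⟩ := hcont.exists_forall_ge' z
    ((h0.eventually (gt_mem_nhds hwz)).mono fun x hx => hx.le)
  set S := ‖v y‖ ^ 2 / ψ y with hS
  have hSpos : 0 < S := hwz.trans_le (hy z)
  have hSy : S * ψ y = ‖v y‖ ^ 2 := div_mul_cancel₀ _ (hpos y).ne'
  -- With the maximal ratio `S` frozen, `‖v‖² - S ψ` is maximal at `y`, so its derivative vanishes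
  -- there. Evaluated on `β y`, this replaces `Dv β` in the equation by the rate `κ`; no regularity
  -- of `β` is needed.
  have hmax : IsLocalMax (fun z => ‖v z‖ ^ 2 - S * ψ z) y := by
    refine Eventually.of_forall fun x => ?_
    have := (div_le_iff₀ (hpos x)).1 (hy x)
    simp only [hSy]
    linarith
  have hder : HasFDerivAt (fun z => ‖v z‖ ^ 2 - S * ψ z)
      (2 • (innerSL ℝ (v y)).comp (fderiv ℝ v y) - S • fderiv ℝ ψ y) y :=
    ((hv y).hasFDerivAt.norm_sq).sub ((hψ y).hasFDerivAt.const_mul S)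
  have hzero := hmax.hasFDerivAt_eq_zero hder
  have h1 : 2 * inner ℝ (v y) (fderiv ℝ v y (β y)) = S * fderiv ℝ ψ y (β y) := by
    have := congrArg (fun T : Z →L[ℝ] ℝ => T (β y)) hzero
    simp at this
    linarith
  have h2 : inner ℝ (v y) (fderiv ℝ v y (β y)) ≤ κ * ‖v y‖ ^ 2 := by
    have := mul_le_mul_of_nonneg_left (hD y) hSpos.le
    rw [← hSy]
    linarith
  have h3 : ρ * ‖v y‖ ^ 2 = inner ℝ (v y) (fderiv ℝ v y (β y)) + inner ℝ (v y) (F y) := by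
    rw [← inner_add_right, ← pde, inner_smul_right, real_inner_self_eq_norm_sq]
  have hvy : 0 < ‖v y‖ := by
    have : 0 < ‖v y‖ ^ 2 := hSy ▸ mul_pos hSpos (hpos y)
    exact lt_of_le_of_ne (norm_nonneg _) fun h => by simp [← h] at this
  have h4 : (ρ - κ) * ‖v y‖ ≤ ‖F y‖ := by
    have := real_inner_le_norm (v y) (F y)
    refine le_of_mul_le_mul_left ?_ hvy
    nlinarith
  have h5 : (ρ - κ) ^ 2 * S ≤ M := by
    refine le_of_mul_le_mul_right ?_ (hpos y)
    have : ((ρ - κ) * ‖v y‖) ^ 2 ≤ ‖F y‖ ^ 2 := by gcongr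
    calc (ρ - κ) ^ 2 * S * ψ y = ((ρ - κ) * ‖v y‖) ^ 2 := by rw [mul_assoc, hSy]; ring
      _ ≤ _ := this.trans (hF y)
  have h6 : ‖v z‖ ^ 2 ≤ S * ψ z := (div_le_iff₀ (hpos z)).1 (hy z)
  have h7 : (ρ - κ) ^ 2 * ‖v z‖ ^ 2 ≤ (ρ - κ) ^ 2 * (S * ψ z) := by gcongr
  have h8 : (ρ - κ) ^ 2 * S * ψ z ≤ M * ψ z := mul_le_mul_of_nonneg_right h5 (hpos z).le
  nlinarith

variable {d p n : ℕ}

theorem hasFDerivAt_norm_sq_id (x : E d) :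
    HasFDerivAt (fun x : E d => ‖x‖ ^ 2) ((2 : ℝ) • innerSL ℝ x) x := by
  have h : HasFDerivAt (fun x : E d => ‖x‖ ^ 2)
      (2 • (innerSL ℝ x).comp (ContinuousLinearMap.id ℝ (E d))) x := (hasFDerivAt_id x).norm_sq
  rwa [ContinuousLinearMap.comp_id, two_smul, ← two_smul ℝ] at h

/-- A solution of polynomial growth of the transport equation with data of linear growth
has linear growth, with a constant that does not depend on the solution. -/
theorem norm_le_of_transport {u : E d → E n} (hu : Differentiable ℝ u) {b : E d → E d}
    {F : E d → E n} {ρ Γ Φ M : ℝ} {m : ℕ} (hM : ∀ x, ‖u x‖ ≤ M * (1 + ‖x‖ ^ m))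
    (pde : ∀ x, ρ • u x = fderiv ℝ u x (b x) + F x)
    (hb : ∀ x, ‖b x‖ ≤ Γ * (1 + ‖x‖)) (hF : ∀ x, ‖F x‖ ≤ Φ * (1 + ‖x‖))
    (hρ : 2 * Γ * (1 + m) < ρ) (x : E d) :
    (ρ - 2 * Γ * (1 + m)) * ‖u x‖ ≤ 2 * Φ * (1 + ‖x‖) := by
  set κ := 2 * Γ * (1 + m) with hκ
  have hΓ : 0 ≤ Γ := by simpa using (norm_nonneg _).trans (hb 0)
  have hΦ : 0 ≤ Φ := by simpa using (norm_nonneg _).trans (hF 0)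
  -- The `m` extra factors make the weight outgrow `‖u‖²`. Each of the `1 + m` factors has
  -- logarithmic derivative at most `4 Γ` along `b`, whatever `ε` is; this is `2 κ`, and `ε` can be
  -- sent to 0.
  have key : ∀ ε : ℝ, 0 < ε → ε ≤ 1 → (ρ - κ) ^ 2 * ‖u x‖ ^ 2 ≤
      2 * Φ ^ 2 * ((1 + ‖x‖ ^ 2) * (1 + ε * ‖x‖ ^ 2) ^ m) := by
    intro ε hε hε1
    have h1 : ∀ x : E d, HasFDerivAt (fun x : E d => 1 + ‖x‖ ^ 2) ((2 : ℝ) • innerSL ℝ x) x :=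
      fun x => (hasFDerivAt_norm_sq_id x).const_add 1
    have h2 : ∀ x : E d, HasFDerivAt (fun x : E d => 1 + ε * ‖x‖ ^ 2)
        (ε • (2 : ℝ) • innerSL ℝ x) x :=
      fun x => ((hasFDerivAt_norm_sq_id x).const_mul ε).const_add 1
    have h3 := fun x => (h1 x).mul ((h2 x).pow m)
    have hxb : ∀ x, inner ℝ x (b x) ≤ Γ * (‖x‖ + ‖x‖ ^ 2) := fun x =>
      (real_inner_le_norm _ _).trans
        ((mul_le_mul_of_nonneg_left (hb x) (norm_nonneg x)).trans_eq (by ring))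
    refine sq_norm_le_of_transport (v := u) (ψ := fun x => (1 + ‖x‖ ^ 2) * (1 + ε * ‖x‖ ^ 2) ^ m)
      (β := b) (F := F) hu (fun x => (h3 x).differentiableAt) (fun x => by positivity)
      hρ pde ?_ ?_ ?_ x
    · intro x
      erw [(h3 x).fderiv]
      have e1 : inner ℝ x (b x) ≤ 2 * Γ * (1 + ‖x‖ ^ 2) := by
        nlinarith [hxb x, sq_nonneg (‖x‖ - 1), mul_nonneg hΓ (sq_nonneg (‖x‖ - 1))]
      have e2 : ε * inner ℝ x (b x) ≤ 2 * Γ * (1 + ε * ‖x‖ ^ 2) := by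
        have : ε * inner ℝ x (b x) ≤ ε * (Γ * (‖x‖ + ‖x‖ ^ 2)) := by gcongr; exact hxb x
        have h' : ε * ‖x‖ ≤ 1 + ε * ‖x‖ ^ 2 := by
          nlinarith [mul_nonneg hε.le (sq_nonneg (‖x‖ - 1)), mul_nonneg hε.le (sq_nonneg ‖x‖)]
        nlinarith [mul_nonneg hΓ (sub_nonneg.2 h')]
      have hA : 0 < 1 + ‖x‖ ^ 2 := by positivity
      have hB : 0 < 1 + ε * ‖x‖ ^ 2 := by positivity
      simp only [add_apply, smul_apply, smul_eq_mul,
        innerSL_apply_apply, nsmul_eq_mul]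
      rcases m with _ | m
      · simp [hκ]
        nlinarith
      · simp only [Nat.add_sub_cancel, hκ]
        have e3 := mul_le_mul_of_nonneg_right e1 (pow_pos hB (m + 1)).le
        have e4 := mul_le_mul_of_nonneg_left e2
          (by positivity : 0 ≤ ((m + 1 : ℕ) : ℝ) * ((1 + ‖x‖ ^ 2) * (1 + ε * ‖x‖ ^ 2) ^ m))
        rw [pow_succ (1 + ε * ‖x‖ ^ 2)] at e3 ⊢
        linarith
    · intro x
      have e1 : ‖F x‖ ^ 2 ≤ (Φ * (1 + ‖x‖)) ^ 2 := by gcongr; exact hF x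
      have e2 : (1 + ‖x‖) ^ 2 ≤ 2 * (1 + ‖x‖ ^ 2) := by nlinarith [sq_nonneg (‖x‖ - 1)]
      have e3 : 1 ≤ (1 + ε * ‖x‖ ^ 2) ^ m :=
        one_le_pow₀ (by nlinarith [mul_nonneg hε.le (sq_nonneg ‖x‖)])
      calc ‖F x‖ ^ 2 ≤ Φ ^ 2 * (1 + ‖x‖) ^ 2 := by rw [← mul_pow]; exact e1
        _ ≤ Φ ^ 2 * (2 * (1 + ‖x‖ ^ 2)) := by gcongr
        _ = 2 * Φ ^ 2 * ((1 + ‖x‖ ^ 2) * 1) := by ring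
        _ ≤ _ := by gcongr
    · have hlim : Tendsto (fun x : E d => 4 * M ^ 2 / ε ^ m * (1 + ‖x‖ ^ 2)⁻¹)
          (cocompact (E d)) (𝓝 0) := by
        rw [← mul_zero (4 * M ^ 2 / ε ^ m)]
        refine Tendsto.const_mul _ (tendsto_inv_atTop_zero.comp ?_)
        exact tendsto_atTop_add_const_left _ _
          ((tendsto_pow_atTop two_ne_zero).comp (tendsto_norm_cocompact_atTop (E := E d)))
      refine squeeze_zero (fun x => by positivity) (fun x => ?_) hlim
      rw [← div_eq_mul_inv, div_div, div_le_div_iff₀ (by positivity) (by positivity)]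
      have hA : 1 ≤ 1 + ‖x‖ ^ 2 := by nlinarith [sq_nonneg ‖x‖]
      have e1 : ‖u x‖ ^ 2 ≤ M ^ 2 * (1 + ‖x‖ ^ m) ^ 2 := by
        rw [← mul_pow]; have := hM x; gcongr
      have e2 : (1 + ‖x‖ ^ m) ^ 2 ≤ 4 * (1 + ‖x‖ ^ 2) ^ m := by
        have : (‖x‖ ^ m) ^ 2 ≤ (1 + ‖x‖ ^ 2) ^ m := by
          rw [← pow_mul, mul_comm, pow_mul]; gcongr; linarith
        have h1 : 1 ≤ (1 + ‖x‖ ^ 2) ^ m := one_le_pow₀ hA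
        nlinarith [sq_nonneg (‖x‖ ^ m - 1)]
      have e3 : ε ^ m * (1 + ‖x‖ ^ 2) ^ m ≤ (1 + ε * ‖x‖ ^ 2) ^ m := by
        rw [← mul_pow]; gcongr; linarith
      calc ‖u x‖ ^ 2 * (ε ^ m * (1 + ‖x‖ ^ 2))
          ≤ (M ^ 2 * (4 * (1 + ‖x‖ ^ 2) ^ m)) * (ε ^ m * (1 + ‖x‖ ^ 2)) := by
            gcongr; exact e1.trans (by gcongr)
        _ = 4 * M ^ 2 * ((1 + ‖x‖ ^ 2) * (ε ^ m * (1 + ‖x‖ ^ 2) ^ m)) := by ring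
        _ ≤ _ := by gcongr
  have hlim : (ρ - κ) ^ 2 * ‖u x‖ ^ 2 ≤ 2 * Φ ^ 2 * (1 + ‖x‖ ^ 2) := by
    have hc : Tendsto (fun ε : ℝ => 2 * Φ ^ 2 * ((1 + ‖x‖ ^ 2) * (1 + ε * ‖x‖ ^ 2) ^ m))
        (𝓝[>] 0) (𝓝 (2 * Φ ^ 2 * (1 + ‖x‖ ^ 2))) := by
      have : Continuous (fun ε : ℝ => 2 * Φ ^ 2 * ((1 + ‖x‖ ^ 2) * (1 + ε * ‖x‖ ^ 2) ^ m)) := by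
        fun_prop
      have h := this.tendsto 0
      simp only [zero_mul, add_zero, one_pow, mul_one] at h
      exact h.mono_left nhdsWithin_le_nhds
    refine ge_of_tendsto hc ?_
    filter_upwards [Ioc_mem_nhdsGT (zero_lt_one' ℝ)] with ε hε using key ε hε.1 hε.2
  refine (abs_le_of_sq_le_sq' ?_ (by positivity)).2
  nlinarith [sq_nonneg Φ, norm_nonneg x, mul_nonneg (sq_nonneg Φ) (norm_nonneg x),
    mul_nonneg (sq_nonneg Φ) (sq_nonneg ‖x‖)]

/-- A solution of linear growth of the transport equation with Lipschitz data is Lipschitz,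
with a constant that does not depend on the solution. -/
theorem norm_sub_le_of_transport {u : E d → E n} (hu : Differentiable ℝ u) {b : E d → E d}
    {F : E d → E n} {ρ Γ L B Φ : ℝ} (hL : ∀ x, ‖u x‖ ≤ L * (1 + ‖x‖))
    (pde : ∀ x, ρ • u x = fderiv ℝ u x (b x) + F x)
    (hb : ∀ x, ‖b x‖ ≤ Γ * (1 + ‖x‖)) (hB0 : 0 ≤ B) (hB : ∀ x y, ‖b x - b y‖ ≤ B * ‖x - y‖)
    (hΦ : 0 ≤ Φ) (hF : ∀ x y, ‖F x - F y‖ ≤ Φ * ‖x - y‖)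
    (hρ : B + 4 * Γ < ρ) (x y : E d) :
    (ρ - (B + 4 * Γ)) * ‖u x - u y‖ ≤ Φ * ‖x - y‖ := by
  set κ := B + 4 * Γ with hκ
  have hΓ : 0 ≤ Γ := by simpa using (norm_nonneg _).trans (hb 0)
  -- Doubling of variables: `u x - u y` solves a transport equation on the product space with drift
  -- `(b x, b y)`. In the weight, `+ ε` gives positivity on the diagonal and the squared factor
  -- gives decay of the quotient at infinity. Their rates along the drift, `2 B` and `8 Γ`, add up
  -- to `2 κ`.
  have key : ∀ ε : ℝ, 0 < ε → ε ≤ 1 → (ρ - κ) ^ 2 * ‖u x - u y‖ ^ 2 ≤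
      Φ ^ 2 * ((‖x - y‖ ^ 2 + ε) * (1 + ε * (‖x‖ ^ 2 + ‖y‖ ^ 2)) ^ 2) := by
    intro ε hε hε1
    let Z := E d × E d
    let p1 : Z →L[ℝ] E d := ContinuousLinearMap.fst ℝ (E d) (E d)
    let p2 : Z →L[ℝ] E d := ContinuousLinearMap.snd ℝ (E d) (E d)
    have h1 : ∀ z : Z, HasFDerivAt (fun z : Z => ‖z.1 - z.2‖ ^ 2 + ε)
        (((2 : ℝ) • innerSL ℝ (z.1 - z.2)).comp (p1 - p2)) z := fun z =>
      (HasFDerivAt.comp (f := fun z : Z => z.1 - z.2) z (hasFDerivAt_norm_sq_id (z.1 - z.2))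
        (p1 - p2).hasFDerivAt).add_const ε
    have h2 : ∀ z : Z, HasFDerivAt (fun z : Z => 1 + ε * (‖z.1‖ ^ 2 + ‖z.2‖ ^ 2))
        (ε • (((2 : ℝ) • innerSL ℝ z.1).comp p1 + ((2 : ℝ) • innerSL ℝ z.2).comp p2)) z := fun z =>
      ((((hasFDerivAt_norm_sq_id z.1).comp z p1.hasFDerivAt).add
        ((hasFDerivAt_norm_sq_id z.2).comp z p2.hasFDerivAt)).const_mul ε).const_add 1
    have h3 := fun z => (h1 z).mul ((h2 z).pow 2)
    have hv : ∀ z : Z, HasFDerivAt (fun z : Z => u z.1 - u z.2)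
        ((fderiv ℝ u z.1).comp p1 - (fderiv ℝ u z.2).comp p2) z := fun z =>
      ((hu z.1).hasFDerivAt.comp z p1.hasFDerivAt).sub ((hu z.2).hasFDerivAt.comp z p2.hasFDerivAt)
    have hxb : ∀ x, inner ℝ x (b x) ≤ Γ * (‖x‖ + ‖x‖ ^ 2) := fun x =>
      (real_inner_le_norm _ _).trans
        ((mul_le_mul_of_nonneg_left (hb x) (norm_nonneg x)).trans_eq (by ring))
    refine sq_norm_le_of_transport (v := fun z : Z => u z.1 - u z.2)
      (ψ := fun z : Z => (‖z.1 - z.2‖ ^ 2 + ε) * (1 + ε * (‖z.1‖ ^ 2 + ‖z.2‖ ^ 2)) ^ 2)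
      (β := fun z => (b z.1, b z.2)) (F := fun z => F z.1 - F z.2)
      (fun z => (hv z).differentiableAt) (fun z => (h3 z).differentiableAt)
      (fun z => by positivity) hρ (fun z => ?_) (fun z => ?_) (fun z => ?_) ?_ (x, y)
    · rw [(hv z).fderiv, smul_sub, pde, pde]
      change _ = fderiv ℝ u z.1 (b z.1) - fderiv ℝ u z.2 (b z.2) + (F z.1 - F z.2)
      abel
    · obtain ⟨x, y⟩ := z
      erw [(h3 (x, y)).fderiv]
      simp only [add_apply, smul_apply, smul_eq_mul,
        innerSL_apply_apply, nsmul_eq_mul, ContinuousLinearMap.comp_apply, sub_apply]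
      change (‖x - y‖ ^ 2 + ε) * ((2 : ℕ) * (1 + ε * (‖x‖ ^ 2 + ‖y‖ ^ 2)) ^ 1 *
        (ε * (2 * inner ℝ x (b x) + 2 * inner ℝ y (b y)))) +
        (1 + ε * (‖x‖ ^ 2 + ‖y‖ ^ 2)) ^ 2 * (2 * inner ℝ (x - y) (b x - b y)) ≤ _
      have hA : 0 ≤ ‖x - y‖ ^ 2 + ε := by positivity
      have hB' : 0 < 1 + ε * (‖x‖ ^ 2 + ‖y‖ ^ 2) := by positivity
      have hBi : inner ℝ (x - y) (b x - b y) ≤ B * ‖x - y‖ ^ 2 :=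
        (real_inner_le_norm _ _).trans
          ((mul_le_mul_of_nonneg_left (hB x y) (norm_nonneg _)).trans_eq (by ring))
      have hBε : 0 ≤ B * ε := mul_nonneg hB0 hε.le
      have e1 : inner ℝ (x - y) (b x - b y) ≤ B * (‖x - y‖ ^ 2 + ε) := by linarith
      have e2 : ε * (inner ℝ x (b x) + inner ℝ y (b y)) ≤
          2 * Γ * (1 + ε * (‖x‖ ^ 2 + ‖y‖ ^ 2)) := by
        have h' : ε * (‖x‖ + ‖y‖) ≤ 1 + (1 + ε * (‖x‖ ^ 2 + ‖y‖ ^ 2)) := by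
          nlinarith [mul_nonneg hε.le (sq_nonneg (‖x‖ - 1)), mul_nonneg hε.le (sq_nonneg ‖x‖),
            mul_nonneg hε.le (sq_nonneg (‖y‖ - 1)), mul_nonneg hε.le (sq_nonneg ‖y‖)]
        have : ε * (inner ℝ x (b x) + inner ℝ y (b y)) ≤
          ε * (Γ * (‖x‖ + ‖x‖ ^ 2) + Γ * (‖y‖ + ‖y‖ ^ 2)) := by gcongr; exacts [hxb x, hxb y]
        nlinarith [mul_nonneg hΓ (sub_nonneg.2 h')]
      have e3 := mul_le_mul_of_nonneg_right e1 (sq_nonneg (1 + ε * (‖x‖ ^ 2 + ‖y‖ ^ 2)))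
      have e4 := mul_le_mul_of_nonneg_left e2 (mul_nonneg hA hB'.le)
      simp only [hκ, pow_one, Nat.cast_ofNat]
      linarith
    · have e1 : ‖F z.1 - F z.2‖ ^ 2 ≤ (Φ * ‖z.1 - z.2‖) ^ 2 := by gcongr; exact hF _ _
      have e3 : 1 ≤ (1 + ε * (‖z.1‖ ^ 2 + ‖z.2‖ ^ 2)) ^ 2 := by
        refine one_le_pow₀ ?_
        have : 0 ≤ ε * (‖z.1‖ ^ 2 + ‖z.2‖ ^ 2) := by positivity
        linarith
      calc _ ≤ Φ ^ 2 * ((‖z.1 - z.2‖ ^ 2 + 0) * 1) := by simpa [mul_pow] using e1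
        _ ≤ _ := by gcongr
    · have hlim : Tendsto (fun z : Z => 8 * L ^ 2 / ε ^ 3 * (1 + ‖z‖ ^ 2)⁻¹)
          (cocompact Z) (𝓝 0) := by
        rw [← mul_zero (8 * L ^ 2 / ε ^ 3)]
        refine Tendsto.const_mul _ (tendsto_inv_atTop_zero.comp ?_)
        exact tendsto_atTop_add_const_left _ _
          ((tendsto_pow_atTop two_ne_zero).comp (tendsto_norm_cocompact_atTop (E := Z)))
      refine squeeze_zero (fun x => by positivity) (fun z => ?_) hlim
      rw [← div_eq_mul_inv, div_div, div_le_div_iff₀ (by positivity) (by positivity)]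
      obtain ⟨x, y⟩ := z
      set s := 1 + (‖x‖ ^ 2 + ‖y‖ ^ 2) with hs
      have hs0 : 0 < s := by positivity
      have e1 : ‖u x - u y‖ ^ 2 ≤ L ^ 2 * (8 * s) := by
        have h1 : ‖u x - u y‖ ≤ L * (2 + ‖x‖ + ‖y‖) :=
          (norm_sub_le _ _).trans (by linarith [hL x, hL y])
        calc _ ≤ (L * (2 + ‖x‖ + ‖y‖)) ^ 2 := by gcongr
          _ = L ^ 2 * (2 + ‖x‖ + ‖y‖) ^ 2 := by ring
          _ ≤ _ := by
            gcongr
            nlinarith [sq_nonneg (‖x‖ - 1), sq_nonneg (‖y‖ - 1), sq_nonneg (‖x‖ - ‖y‖)]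
      have e2 : 1 + ‖(x, y)‖ ^ 2 ≤ s := by
        rw [Prod.norm_def]
        rcases max_cases ‖x‖ ‖y‖ with ⟨h, -⟩ | ⟨h, -⟩ <;> simp only [h, hs] <;>
          nlinarith [sq_nonneg ‖x‖, sq_nonneg ‖y‖]
      have e3 : ε * s ≤ 1 + ε * (‖x‖ ^ 2 + ‖y‖ ^ 2) := by rw [hs]; linarith
      calc ‖u x - u y‖ ^ 2 * (ε ^ 3 * (1 + ‖(x, y)‖ ^ 2)) ≤
          (L ^ 2 * (8 * s)) * (ε ^ 3 * s) := by gcongr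
        _ = 8 * L ^ 2 * ((0 + ε) * (ε * s) ^ 2) := by ring
        _ ≤ 8 * L ^ 2 * ((‖x - y‖ ^ 2 + ε) * (1 + ε * (‖x‖ ^ 2 + ‖y‖ ^ 2)) ^ 2) := by
          gcongr; positivity
  have hlim : (ρ - κ) ^ 2 * ‖u x - u y‖ ^ 2 ≤ Φ ^ 2 * ‖x - y‖ ^ 2 := by
    have hc : Tendsto (fun ε : ℝ => Φ ^ 2 * ((‖x - y‖ ^ 2 + ε) *
        (1 + ε * (‖x‖ ^ 2 + ‖y‖ ^ 2)) ^ 2)) (𝓝[>] 0) (𝓝 (Φ ^ 2 * ‖x - y‖ ^ 2)) := by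
      have : Continuous (fun ε : ℝ => Φ ^ 2 * ((‖x - y‖ ^ 2 + ε) *
        (1 + ε * (‖x‖ ^ 2 + ‖y‖ ^ 2)) ^ 2)) := by fun_prop
      have h := this.tendsto 0
      simp only [zero_mul, add_zero, one_pow, mul_one] at h
      exact h.mono_left nhdsWithin_le_nhds
    refine ge_of_tendsto hc ?_
    filter_upwards [Ioc_mem_nhdsGT (zero_lt_one' ℝ)] with ε hε using key ε hε.1 hε.2
  rw [← mul_pow, ← mul_pow] at hlim
  exact (abs_le_of_sq_le_sq' hlim (by positivity)).2

/-! ### Gradients and convexity of the running cost -/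

section Cost

variable {C : Constants} {l : E d → E p → ℝ}

theorem gradX_eq (h : ContDiff ℝ 2 (fun z : E d × E p => l z.1 z.2)) (x : E d) (a : E p) :
    gradX l x a = (InnerProductSpace.toDual ℝ (E d)).symm
      ((fderiv ℝ (fun z : E d × E p => l z.1 z.2) (x, a)).comp
        (ContinuousLinearMap.inl ℝ (E d) (E p))) := by
  have h1 := (h.differentiable (by norm_num) (x, a)).hasFDerivAt
  have h2 := HasFDerivAt.comp (f := fun y : E d => (y, a)) x h1 (hasFDerivAt_prodMk_left x a)
  rw [gradX, gradient]
  congr 1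
  exact h2.fderiv

theorem gradA_eq (h : ContDiff ℝ 2 (fun z : E d × E p => l z.1 z.2)) (x : E d) (a : E p) :
    gradA l x a = (InnerProductSpace.toDual ℝ (E p)).symm
      ((fderiv ℝ (fun z : E d × E p => l z.1 z.2) (x, a)).comp
        (ContinuousLinearMap.inr ℝ (E d) (E p))) := by
  have h1 := (h.differentiable (by norm_num) (x, a)).hasFDerivAt
  have h2 := HasFDerivAt.comp (f := fun b : E p => (x, b)) a h1 (hasFDerivAt_prodMk_right x a)
  rw [gradA, gradient]
  congr 1
  exact h2.fderiv

theorem contDiff_gradX (h : ContDiff ℝ 2 (fun z : E d × E p => l z.1 z.2)) :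
    ContDiff ℝ 1 (fun z : E d × E p => gradX l z.1 z.2) := by
  simp only [gradX_eq h]
  exact (LinearIsometryEquiv.contDiff _).comp
    ((h.fderiv_right (m := 1) (by norm_num)).clm_comp contDiff_const)

theorem contDiff_gradA (h : ContDiff ℝ 2 (fun z : E d × E p => l z.1 z.2)) :
    ContDiff ℝ 1 (fun z : E d × E p => gradA l z.1 z.2) := by
  simp only [gradA_eq h]
  exact (LinearIsometryEquiv.contDiff _).comp
    ((h.fderiv_right (m := 1) (by norm_num)).clm_comp contDiff_const)

theorem hasFDerivAt_cost (h : ContDiff ℝ 2 (fun z : E d × E p => l z.1 z.2)) (x : E d) (a : E p) :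
    HasFDerivAt (fun z : E d × E p => l z.1 z.2)
      ((innerSL ℝ (gradX l x a)).comp (ContinuousLinearMap.fst ℝ _ _) +
        (innerSL ℝ (gradA l x a)).comp (ContinuousLinearMap.snd ℝ _ _)) (x, a) := by
  have e : (innerSL ℝ (gradX l x a)).comp (ContinuousLinearMap.fst ℝ (E d) (E p)) +
      (innerSL ℝ (gradA l x a)).comp (ContinuousLinearMap.snd ℝ (E d) (E p)) =
      fderiv ℝ (fun z : E d × E p => l z.1 z.2) (x, a) := by
    ext v <;> simp [gradX_eq h, gradA_eq h]
  have h1 := (h.differentiable (by norm_num) (x, a)).hasFDerivAt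
  rwa [← e] at h1

/-- The Lipschitz bound is used on the unit ball around `x`, where `1 + max ‖y‖ ‖x‖ ≤ 2 + ‖x‖`; this
is the origin of the 2. -/
theorem AssumptionCost.norm_gradX_le (hl : AssumptionCost C l) (x : E d) (a : E p) :
    ‖gradX l x a‖ ≤ C.lb * (2 + ‖x‖ + ‖a‖) := by
  rw [gradX, gradient, LinearIsometryEquiv.norm_map]
  refine norm_fderiv_le_of_lip' ℝ (mul_nonneg C.lb_pos.le (by positivity)) ?_
  filter_upwards [Metric.ball_mem_nhds x one_pos] with y hy
  have hyx : ‖y - x‖ < 1 := by simpa [dist_eq_norm] using hy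
  have h1 : max ‖y‖ ‖x‖ ≤ 1 + ‖x‖ := by
    refine max_le ?_ (by linarith)
    have := norm_le_norm_add_norm_sub x y
    rw [norm_sub_rev] at this
    linarith
  refine (hl.lipschitz y x a a).trans ?_
  rw [sub_self, norm_zero, add_zero, max_self, mul_assoc]
  refine mul_le_mul_of_nonneg_left ?_ C.lb_pos.le
  exact mul_le_mul_of_nonneg_right (by linarith) (norm_nonneg _)

theorem AssumptionCost.norm_gradX_sub_le (hl : AssumptionCost C l) (x x' : E d) (a a' : E p) :
    ‖gradX l x a - gradX l x' a'‖ ≤ C.l2 * (‖x - x'‖ + ‖a - a'‖) := by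
  have hd := (contDiff_gradX hl.smooth).differentiable one_ne_zero
  have h1 : ‖gradX l x a - gradX l x' a‖ ≤ C.l2 * ‖x - x'‖ :=
    convex_univ.norm_image_sub_le_of_norm_fderiv_le (𝕜 := ℝ) (f := fun y => gradX l y a)
      (fun y _ => (hd (y, a)).comp (f := fun y : E d => (y, a)) y (by fun_prop))
      (fun y _ => hl.hessXX_le y a) trivial trivial
  have h2 : ‖gradX l x' a - gradX l x' a'‖ ≤ C.l2 * ‖a - a'‖ :=
    convex_univ.norm_image_sub_le_of_norm_fderiv_le (𝕜 := ℝ) (f := fun b => gradX l x' b)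
      (fun b _ => (hd (x', b)).comp (f := fun b : E p => (x', b)) b (by fun_prop))
      (fun b _ => hl.hessXA_le x' b) trivial trivial
  calc _ ≤ ‖gradX l x a - gradX l x' a‖ + ‖gradX l x' a - gradX l x' a'‖ :=
      norm_sub_le_norm_sub_add_norm_sub _ _ _
    _ ≤ _ := by linarith

theorem AssumptionCost.norm_gradA_sub_le (hl : AssumptionCost C l) (x x' : E d) (a : E p) :
    ‖gradA l x a - gradA l x' a‖ ≤ C.l2 * ‖x - x'‖ := by
  have hd := (contDiff_gradA hl.smooth).differentiable one_ne_zero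
  exact convex_univ.norm_image_sub_le_of_norm_fderiv_le (𝕜 := ℝ) (f := fun y => gradA l y a)
    (fun y _ => (hd (y, a)).comp (f := fun y : E d => (y, a)) y (by fun_prop))
    (fun y _ => hl.hessAX_le y a) trivial trivial

/-- A positive operator that is bounded below by `c` in norm is bounded below by `c` as a form. -/
theorem le_inner_of_le_norm {T : E n →ₗ[ℝ] E n} (hT : T.IsSymmetric)
    (hpos : ∀ v, 0 ≤ inner ℝ (T v) v) {c : ℝ} (hc : ∀ v, c * ‖v‖ ≤ ‖T v‖) (v : E n) :
    c * ‖v‖ ^ 2 ≤ inner ℝ (T v) v := by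
  have hn : Module.finrank ℝ (E n) = n := by simp
  -- On an eigenvector, the norm bound reads `c ≤ |eigenvalue|`, and positivity removes the absolute
  -- value.
  set e := hT.eigenvectorBasis hn
  have he : ∀ i, T (e i) = hT.eigenvalues hn i • e i := fun i => hT.apply_eigenvectorBasis hn i
  have h1 : ∀ i, c ≤ hT.eigenvalues hn i := fun i => by
    have h0 : 0 ≤ hT.eigenvalues hn i := by
      have := hpos (e i)
      rw [he, inner_smul_left, real_inner_self_eq_norm_sq, e.norm_eq_one] at this
      simpa using this
    have := hc (e i)
    rwa [he, norm_smul, e.norm_eq_one, mul_one, mul_one, Real.norm_of_nonneg h0] at this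
  rw [← e.sum_inner_mul_inner, ← real_inner_self_eq_norm_sq, ← e.sum_inner_mul_inner,
    Finset.mul_sum]
  refine Finset.sum_le_sum fun i _ => ?_
  rw [hT, he, inner_smul_right, real_inner_comm v (e i), mul_assoc]
  exact mul_le_mul_of_nonneg_right (h1 i) (mul_self_nonneg _)

/-- Along a line, convexity makes the directional derivative of the cost monotone, and the Hessian
form is the derivative of that function. -/
theorem AssumptionCost.hess_nonneg (hl : AssumptionCost C l) (x : E d) (a v : E p) :
    0 ≤ inner ℝ (fderiv ℝ (fun b => gradA l x b) a v) v := by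
  have hd := (contDiff_gradA hl.smooth).differentiable one_ne_zero
  have hg : ∀ b, HasFDerivAt (fun b => gradA l x b) (fderiv ℝ (fun b => gradA l x b) b) b :=
    fun b => ((hd (x, b)).comp (f := fun b : E p => (x, b)) b (by fun_prop)).hasFDerivAt
  have hline : ∀ t : ℝ, HasDerivAt (fun t : ℝ => a + t • v) v t := fun t => by
    simpa using ((hasDerivAt_id t).smul_const v).const_add a
  have hφ : ∀ t : ℝ, HasDerivAt (fun t : ℝ => l x (a + t • v))
      (inner ℝ (gradA l x (a + t • v)) v) t := fun t => by
    have := (hasFDerivAt_cost hl.smooth x (a + t • v)).comp_hasDerivAt t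
      ((hasDerivAt_const t x).prodMk (hline t))
    simp at this
    exact this
  have hconv : ConvexOn ℝ Set.univ (fun t : ℝ => l x (a + t • v)) := by
    have := (hl.strictConvex x).convexOn.comp_affineMap (AffineMap.lineMap a (a + v))
    simpa [Function.comp_def, AffineMap.lineMap_apply, add_comm] using this
  have hmono : Monotone (fun t : ℝ => inner ℝ (gradA l x (a + t • v)) v) := by
    have := hconv.monotoneOn_deriv fun t _ => (hφ t).differentiableAt
    rw [monotoneOn_univ] at this
    exact (funext fun t => (hφ t).deriv : deriv _ = _) ▸ this
  have hder : HasDerivAt (fun t : ℝ => inner ℝ (gradA l x (a + t • v)) v)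
      (inner ℝ (fderiv ℝ (fun b => gradA l x b) a v) v) 0 := by
    have h0 : HasFDerivAt (fun b => gradA l x b) (fderiv ℝ (fun b => gradA l x b) a)
      (a + (0 : ℝ) • v) := by simpa using hg a
    simpa using (h0.comp_hasDerivAt (0 : ℝ) (hline 0)).inner ℝ (hasDerivAt_const (0 : ℝ) v)
  rw [← hder.deriv]
  exact hmono.deriv_nonneg

theorem AssumptionCost.hess_symm (hl : AssumptionCost C l) (x : E d) (a v w : E p) :
    inner ℝ (fderiv ℝ (fun b => gradA l x b) a v) w =
      inner ℝ v (fderiv ℝ (fun b => gradA l x b) a w) := by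
  have hf : ContDiff ℝ 2 (fun b => l x b) := hl.smooth.comp (contDiff_prodMk_right x)
  have hs := (hf.contDiffAt (x := a)).isSymmSndFDerivAt (by simp)
  have hd := (contDiff_gradA hl.smooth).differentiable one_ne_zero
  have hg := ((hd (x, a)).comp (f := fun b : E p => (x, b)) a (by fun_prop)).hasFDerivAt
  have hf' := ((hf.fderiv_right (m := 1) (by norm_num)).differentiable one_ne_zero a).hasFDerivAt
  have key : ∀ v w, inner ℝ (fderiv ℝ (fun b => gradA l x b) a v) w =
      fderiv ℝ (fderiv ℝ (fun b => l x b)) a v w := fun v w => by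
    have h1 := hg.inner ℝ (hasFDerivAt_const w a)
    have h2 := hf'.clm_apply (hasFDerivAt_const w a)
    have e : (fun b => inner ℝ (gradA l x b) w) = fun b => fderiv ℝ (fun b => l x b) b w := by
      ext b
      simp [gradA, gradient]
    have h3 := congrArg (fun T : E p →L[ℝ] ℝ => T v) ((e ▸ h1).unique h2)
    simpa [Function.comp_def] using h3
  rw [real_inner_comm _ v, key, key]
  exact hs v w

/-- The assumption bounds only the norm of the Hessian applied to a vector. With symmetry and
nonnegativity this becomes a lower bound for the quadratic form, which is integrated along the
segment from `a'` to `a`. -/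
theorem AssumptionCost.strongly_monotone (hl : AssumptionCost C l) (x : E d) (a a' : E p) :
    C.cs * ‖a - a'‖ ≤ ‖gradA l x a - gradA l x a'‖ := by
  have hd := (contDiff_gradA hl.smooth).differentiable one_ne_zero
  have hg : ∀ b, HasFDerivAt (fun b => gradA l x b) (fderiv ℝ (fun b => gradA l x b) b) b :=
    fun b => ((hd (x, b)).comp (f := fun b : E p => (x, b)) b (by fun_prop)).hasFDerivAt
  set v := a - a' with hv
  have hline : ∀ t : ℝ, HasDerivAt (fun t : ℝ => a' + t • v) v t := fun t => by
    simpa using ((hasDerivAt_id t).smul_const v).const_add a'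
  have hder : ∀ t : ℝ, HasDerivAt (fun t : ℝ => inner ℝ (gradA l x (a' + t • v)) v)
      (inner ℝ (fderiv ℝ (fun b => gradA l x b) (a' + t • v) v) v) t := fun t => by
    simpa using ((hg _).comp_hasDerivAt t (hline t)).inner ℝ (hasDerivAt_const t v)
  have h1 := mul_sub_le_image_sub_of_le_deriv (f := fun t : ℝ => inner ℝ (gradA l x (a' + t • v)) v)
    (fun t => (hder t).differentiableAt) (C := C.cs * ‖v‖ ^ 2) (fun t => by
      rw [(hder t).deriv]
      exact le_inner_of_le_norm (T := (fderiv ℝ (fun b => gradA l x b) (a' + t • v)).toLinearMap)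
        (hl.hess_symm x _) (hl.hess_nonneg x _) (hl.hessAA_ge x _) v) zero_le_one
  simp only [sub_zero, mul_one, one_smul, zero_smul, add_zero, hv, add_sub_cancel,
    ← inner_sub_left] at h1
  rcases (norm_nonneg (a - a')).eq_or_lt with h | h
  · rw [hv, ← h, mul_zero]; exact norm_nonneg _
  · refine le_of_mul_le_mul_right ?_ h
    have := real_inner_le_norm (gradA l x a - gradA l x a') (a - a')
    nlinarith

end Cost

/-! ### Consequences of the affine dependence on the control -/

section Dynamics

variable {C : Constants} {g : E d → E p → E d}

theorem AssumptionDynamics.exists_affine (hg : AssumptionDynamics C g) :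
    ∃ c : E d →L[ℝ] E p, ‖c‖ = C.cb ∧
      ∀ x a, g x a = g x 0 + ContinuousLinearMap.adjoint c a := by
  obtain ⟨g₁, c, -, hc, h⟩ := hg.affine
  exact ⟨c, hc, fun x a => by simp [h]⟩

theorem AssumptionDynamics.cb_nonneg (hg : AssumptionDynamics C g) : 0 ≤ C.cb := by
  obtain ⟨c, hc, -⟩ := hg.exists_affine
  exact hc ▸ norm_nonneg _

theorem AssumptionDynamics.contDiff (hg : AssumptionDynamics C g) :
    ContDiff ℝ 2 (fun z : E d × E p => g z.1 z.2) := by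
  obtain ⟨g₁, c, h₁, -, h⟩ := hg.affine
  simp only [h]
  exact (h₁.comp contDiff_fst).add ((ContinuousLinearMap.contDiff _).comp contDiff_snd)

theorem AssumptionDynamics.contDiff_zero (hg : AssumptionDynamics C g) :
    ContDiff ℝ 2 (fun x => g x 0) :=
  hg.contDiff.comp (contDiff_prodMk_left 0)

/-- The control enters additively, so it disappears under `D_x`. Changing the policy thus leaves
this matrix in the source term unchanged. -/
theorem AssumptionDynamics.Dx_eq (hg : AssumptionDynamics C g) (x : E d) (a : E p) :
    Dx g x a = Dx g x 0 := by
  obtain ⟨c, -, h⟩ := hg.exists_affine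
  have : (fun y => g y a) = fun y => g y 0 + ContinuousLinearMap.adjoint c a :=
    funext fun y => h y a
  rw [Dx, this, fderiv_add_const, Dx]

theorem AssumptionDynamics.contDiff_Dx (hg : AssumptionDynamics C g) :
    ContDiff ℝ 1 (fun x => Dx g x 0) :=
  hg.contDiff_zero.fderiv_right (by norm_num)

theorem AssumptionDynamics.sub_eq_le (hg : AssumptionDynamics C g) (x : E d) (a a' : E p) :
    ‖g x a - g x a'‖ ≤ C.cb * ‖a - a'‖ := by
  obtain ⟨c, hc, h⟩ := hg.exists_affine
  rw [h x a, h x a', add_sub_add_left_eq_sub, ← map_sub, ← hc,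
    ← LinearIsometryEquiv.norm_map ContinuousLinearMap.adjoint c]
  exact ContinuousLinearMap.le_opNorm _ _

theorem AssumptionDynamics.norm_sub_le (hg : AssumptionDynamics C g) (x x' : E d) (a a' : E p) :
    ‖g x a - g x' a'‖ ≤ C.gb * ‖x - x'‖ + C.cb * ‖a - a'‖ := by
  have hd := hg.contDiff.differentiable two_ne_zero
  have h1 : ‖g x a - g x' a‖ ≤ C.gb * ‖x - x'‖ :=
    convex_univ.norm_image_sub_le_of_norm_fderiv_le (𝕜 := ℝ) (f := fun y => g y a)
      (fun y _ => (hd (y, a)).comp (f := fun y : E d => (y, a)) y (by fun_prop))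
      (fun y _ => hg.deriv_le y a) trivial trivial
  calc _ ≤ ‖g x a - g x' a‖ + ‖g x' a - g x' a'‖ := norm_sub_le_norm_sub_add_norm_sub _ _ _
    _ ≤ _ := add_le_add h1 (hg.sub_eq_le _ _ _)

theorem apply_eq_sum_single {F : Type*} [NormedAddCommGroup F] [NormedSpace ℝ F]
    (T : E d →L[ℝ] F) (v : E d) : T v = ∑ i, v i • T (EuclideanSpace.single i (1 : ℝ)) := by
  have hv : v = ∑ i, v i • EuclideanSpace.single i (1 : ℝ) := by
    ext j
    simp [Pi.single_apply]
  conv_lhs => rw [hv]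
  simp only [map_sum, map_smul]

theorem norm_apply_le_sum (T : E d →L[ℝ] E n) (v : E d) :
    ‖T v‖ ≤ (∑ i, ‖T (EuclideanSpace.single i (1 : ℝ))‖) * ‖v‖ := by
  rw [apply_eq_sum_single, Finset.sum_mul]
  refine (norm_sum_le _ _).trans (Finset.sum_le_sum fun i _ => ?_)
  rw [norm_smul, mul_comm]
  gcongr
  exact PiLp.norm_apply_le v i

theorem AssumptionDynamics.norm_fderiv_Dx_le (hg : AssumptionDynamics C g) (x h v : E d) :
    ‖fderiv ℝ (fun y => Dx g y 0) x h v‖ ≤ C.g2 / (1 + ‖x‖) * ‖h‖ * ‖v‖ := by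
  have hd := (hg.contDiff_Dx.differentiable one_ne_zero x).hasFDerivAt
  refine (norm_apply_le_sum _ v).trans ?_
  gcongr
  refine le_trans ?_ (mul_le_mul_of_nonneg_right (hg.deriv2_le x 0) (norm_nonneg h))
  rw [Finset.sum_mul]
  refine Finset.sum_le_sum fun i _ => ?_
  have := (hd.clm_apply (hasFDerivAt_const (EuclideanSpace.single i (1 : ℝ)) x)).fderiv
  rw [this]
  refine le_trans (le_of_eq ?_) (ContinuousLinearMap.le_opNorm _ h)
  simp

theorem AssumptionDynamics.norm_adjoint_Dx_le (hg : AssumptionDynamics C g) (x v : E d) (a : E p) :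
    ‖ContinuousLinearMap.adjoint (Dx g x a) v‖ ≤ C.gb * ‖v‖ := by
  refine (ContinuousLinearMap.le_opNorm _ _).trans ?_
  rw [LinearIsometryEquiv.norm_map]
  gcongr
  exact hg.deriv_le x a

/-- Over `ℝ` the adjoint is linear rather than conjugate-linear; in this form it can be used in the
chain rule. -/
theorem exists_adjointCLM (d : ℕ) : ∃ adj : (E d →L[ℝ] E d) →L[ℝ] (E d →L[ℝ] E d),
    ∀ T, adj T = ContinuousLinearMap.adjoint T :=
  ⟨LinearMap.toContinuousLinearMap
      { toFun := fun T => ContinuousLinearMap.adjoint T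
        map_add' := fun S T => map_add _ S T
        map_smul' := fun r T => by simp }, fun _ => rfl⟩

/-- In the product rule, the second derivative of `g` multiplies `u`, which grows linearly. The
decay `1 / (1 + ‖x‖)` of the second derivative cancels this growth and leaves a global Lipschitz
constant. -/
theorem AssumptionDynamics.norm_adjoint_Dx_sub_le (hg : AssumptionDynamics C g) {u : E d → E d}
    {L Λ : ℝ} (hu : Differentiable ℝ u) (hL : ∀ x, ‖u x‖ ≤ L * (1 + ‖x‖))
    (hΛ : ∀ x, ‖fderiv ℝ u x‖ ≤ Λ) (x y : E d) :
    ‖ContinuousLinearMap.adjoint (Dx g x 0) (u x) - ContinuousLinearMap.adjoint (Dx g y 0) (u y)‖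
      ≤ (C.g2 * L + C.gb * Λ) * ‖x - y‖ := by
  obtain ⟨adj, hadj⟩ := exists_adjointCLM d
  simp only [← hadj]
  have hd : ∀ x, HasFDerivAt (fun x => adj (Dx g x 0) (u x))
      ((adj (Dx g x 0)).comp (fderiv ℝ u x) +
        (adj.comp (fderiv ℝ (fun y => Dx g y 0) x)).flip (u x)) x :=
    fun x => HasFDerivAt.clm_apply
      (adj.hasFDerivAt.comp x (hg.contDiff_Dx.differentiable one_ne_zero x).hasFDerivAt)
      (hu x).hasFDerivAt
  have hL0 : 0 ≤ L := by simpa using (norm_nonneg _).trans (hL 0)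
  have hΛ0 : 0 ≤ Λ := (norm_nonneg _).trans (hΛ 0)
  refine convex_univ.norm_image_sub_le_of_norm_hasFDerivWithin_le (𝕜 := ℝ)
    (fun x _ => (hd x).hasFDerivWithinAt) (fun x _ => ?_) trivial trivial
  refine ContinuousLinearMap.opNorm_le_bound _
    (add_nonneg (mul_nonneg C.g2_pos.le hL0) (mul_nonneg C.gb_pos.le hΛ0)) fun h => ?_
  have h1 : ‖fderiv ℝ (fun y => Dx g y 0) x h‖ ≤ C.g2 / (1 + ‖x‖) * ‖h‖ :=
    ContinuousLinearMap.opNorm_le_bound _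
      (mul_nonneg (div_nonneg C.g2_pos.le (by positivity)) (norm_nonneg _))
      (hg.norm_fderiv_Dx_le x h)
  have h2 : ‖adj (fderiv ℝ (fun y => Dx g y 0) x h) (u x)‖ ≤ C.g2 * L * ‖h‖ := by
    refine (ContinuousLinearMap.le_opNorm _ _).trans ?_
    rw [hadj, LinearIsometryEquiv.norm_map]
    calc _ ≤ (C.g2 / (1 + ‖x‖) * ‖h‖) * (L * (1 + ‖x‖)) := by
          gcongr
          · exact (norm_nonneg _).trans h1
          · exact hL x
      _ = _ := by field_simp
  have h3 : ‖adj (Dx g x 0) (fderiv ℝ u x h)‖ ≤ C.gb * Λ * ‖h‖ := by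
    rw [hadj]
    refine (hg.norm_adjoint_Dx_le _ _ _).trans ?_
    rw [mul_assoc]
    exact mul_le_mul_of_nonneg_left (ContinuousLinearMap.le_of_opNorm_le _ (hΛ x) h) C.gb_pos.le
  rw [add_mul, add_comm]
  exact norm_add_le_of_le h2 h3

end Dynamics

/-! ### Minimizers of the Hamiltonian -/

section Greedy

variable {C : Constants} {g : E d → E p → E d} {l : E d → E p → ℝ}

/-- First-order condition. As the dynamics are affine in `a`, the adjoint variable enters only
through the constant `c q`, so all estimates on policies reduce to estimates on `∇_a l`. -/
theorem gradA_eq_of_isMin (hl : AssumptionCost C l) {c : E d →L[ℝ] E p}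
    (hc : ∀ x a, g x a = g x 0 + ContinuousLinearMap.adjoint c a) {x q : E d} {a : E p}
    (h : ∀ b, Ham g l x q a ≤ Ham g l x q b) : gradA l x a = - c q := by
  have h1 : HasFDerivAt (fun b => Ham g l x q b) (innerSL ℝ (c q) + innerSL ℝ (gradA l x a)) a := by
    have e : (fun b => Ham g l x q b) = fun b => (inner ℝ (g x 0) q + inner ℝ (c q) b) + l x b := by
      ext b
      rw [Ham, hc x b, inner_add_left, ContinuousLinearMap.adjoint_inner_left,
        real_inner_comm b (c q)]
    rw [e]
    refine HasFDerivAt.add (((innerSL ℝ (c q)).hasFDerivAt (x := a)).const_add _) ?_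
    have h1 : HasFDerivAt (fun b => l x b) _ a := HasFDerivAt.comp (f := fun b : E p => (x, b)) a
      (hasFDerivAt_cost hl.smooth x a) (hasFDerivAt_prodMk_right x a)
    have e' : ((innerSL ℝ (gradX l x a)).comp (ContinuousLinearMap.fst ℝ (E d) (E p)) +
        (innerSL ℝ (gradA l x a)).comp (ContinuousLinearMap.snd ℝ (E d) (E p))).comp
        (ContinuousLinearMap.inr ℝ (E d) (E p)) = innerSL ℝ (gradA l x a) := by
      ext v
      simp
    rwa [e'] at h1
  have h2 := IsLocalMin.hasFDerivAt_eq_zero (Eventually.of_forall h) h1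
  rw [← map_add] at h2
  have h3 : c q + gradA l x a = 0 := by
    have := congrArg (fun T : E p →L[ℝ] ℝ => T (c q + gradA l x a)) h2
    exact inner_self_eq_zero.1 this
  exact eq_neg_of_add_eq_zero_right h3

theorem norm_le_of_isMin (hg : AssumptionDynamics C g) (hl : AssumptionCost C l)
    {x q : E d} {a : E p} (h : ∀ b, Ham g l x q a ≤ Ham g l x q b) :
    C.l1 * ‖a‖ ≤ C.c0 + C.cb * ‖q‖ := by
  obtain ⟨c, hc, h'⟩ := hg.exists_affine
  have h1 := hl.gradA_ge x a
  rw [gradA_eq_of_isMin hl h' h, norm_neg] at h1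
  have h2 := c.le_opNorm q
  rw [hc] at h2
  linarith

/-- Strong monotonicity of `∇_a l` bounds the distance of the minimizers by the change in the
first-order condition, whose two sources are `c q` and the dependence of `∇_a l` on `x`. -/
theorem norm_sub_le_of_isMin (hg : AssumptionDynamics C g) (hl : AssumptionCost C l)
    {x x' q q' : E d} {a a' : E p} (h : ∀ b, Ham g l x q a ≤ Ham g l x q b)
    (h' : ∀ b, Ham g l x' q' a' ≤ Ham g l x' q' b) :
    C.cs * ‖a - a'‖ ≤ C.cb * ‖q - q'‖ + C.l2 * ‖x - x'‖ := by
  obtain ⟨c, hc, hgc⟩ := hg.exists_affine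
  refine (hl.strongly_monotone x a a').trans ?_
  have h1 := hl.norm_gradA_sub_le x x' a'
  have h2 : ‖gradA l x a - gradA l x' a'‖ ≤ C.cb * ‖q - q'‖ := by
    rw [gradA_eq_of_isMin hl hgc h, gradA_eq_of_isMin hl hgc h', ← neg_sub', norm_neg, ← map_sub,
      ← hc]
    exact c.le_opNorm _
  rw [norm_sub_rev] at h1
  calc _ ≤ ‖gradA l x a - gradA l x' a'‖ + ‖gradA l x' a' - gradA l x a'‖ :=
      norm_sub_le_norm_sub_add_norm_sub _ _ _
    _ ≤ _ := add_le_add h2 h1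

/-- The greedy policy of a differentiable function is differentiable. -/
theorem IsGreedy.differentiableAt (hg : AssumptionDynamics C g) (hl : AssumptionCost C l)
    {lam : E d → E d} {a : E d → E p} (h : IsGreedy g l lam a) {x : E d}
    (hlam : DifferentiableAt ℝ lam x) : DifferentiableAt ℝ a x := by
  obtain ⟨c, -, hc⟩ := hg.exists_affine
  -- The estimate for minimizers first gives `a y - a x = O(y - x)`. The first-order condition is
  -- then linearized at `(x, a x)` and solved for `a y - a x` with a left inverse of the Hessian in
  -- `a`. Differentiability of `lam` at the single point `x` suffices.
  have hO : (fun y => a y - a x) =O[𝓝 x] fun y => y - x := by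
    have h1 : (fun y => C.cb * ‖lam y - lam x‖ + C.l2 * ‖y - x‖) =O[𝓝 x] fun y => y - x :=
      (hlam.hasFDerivAt.isBigO_sub.norm_left.const_mul_left _).add
        ((Asymptotics.isBigO_refl _ _).norm_left.const_mul_left _)
    refine Asymptotics.IsBigO.trans (.of_bound C.cs⁻¹ (Eventually.of_forall fun y => ?_)) h1
    have h2 := norm_sub_le_of_isMin hg hl (h y) (h x)
    have h3 : 0 ≤ C.cb * ‖lam y - lam x‖ + C.l2 * ‖y - x‖ :=
      (mul_nonneg C.cs_pos.le (norm_nonneg _)).trans h2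
    rw [Real.norm_of_nonneg h3, ← div_eq_inv_mul, le_div_iff₀ C.cs_pos]
    linarith
  have hcont : ContinuousAt a x := by
    have h0 : Tendsto (fun y => y - x) (𝓝 x) (𝓝 0) := by
      exact (by fun_prop : Continuous fun y => y - x).tendsto' x 0 (sub_self x)
    have := hO.trans_tendsto h0
    simpa [ContinuousAt] using this.add_const (a x)
  set D := fderiv ℝ (fun z : E d × E p => gradA l z.1 z.2) (x, a x) with hD
  have hΨ : HasFDerivAt (fun z : E d × E p => gradA l z.1 z.2) D (x, a x) :=
    ((contDiff_gradA hl.smooth).differentiable one_ne_zero _).hasFDerivAt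
  set Q := D.comp (ContinuousLinearMap.inr ℝ (E d) (E p)) with hQ
  have hQeq : fderiv ℝ (fun b => gradA l x b) (a x) = Q :=
    (HasFDerivAt.comp (f := fun b : E p => (x, b)) (a x) hΨ
      (hasFDerivAt_prodMk_right x (a x))).fderiv
  have hinj : LinearMap.ker Q.toLinearMap = ⊥ := by
    rw [LinearMap.ker_eq_bot']
    intro v hv
    have h1 := hl.hessAA_ge x (a x) v
    rw [hQeq] at h1
    have h2 : Q v = 0 := hv
    rw [h2, norm_zero] at h1
    exact norm_eq_zero.1 (le_antisymm (nonpos_of_mul_nonpos_right h1 C.cs_pos) (norm_nonneg v))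
  obtain ⟨R₀, hR₀⟩ := Q.toLinearMap.exists_leftInverse_of_injective hinj
  set R : E p →L[ℝ] E p := LinearMap.toContinuousLinearMap R₀ with hR
  have hRQ : ∀ v, R (Q v) = v := fun v => LinearMap.congr_fun hR₀ v
  have ho1 : (fun y => gradA l y (a y) - gradA l x (a x) - D ((y, a y) - (x, a x)))
      =o[𝓝 x] fun y => y - x := by
    have ht : Tendsto (fun y => (y, a y)) (𝓝 x) (𝓝 (x, a x)) :=
      (continuousAt_id.prodMk hcont).tendsto
    refine (hΨ.isLittleO.comp_tendsto ht).trans_isBigO ?_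
    exact (Asymptotics.isBigO_refl _ _).prod_left hO
  have ho2 := hlam.hasFDerivAt.isLittleO
  have ho3 : (fun y => -(R (gradA l y (a y) - gradA l x (a x) - D ((y, a y) - (x, a x)))) -
      R (c (lam y - lam x - fderiv ℝ lam x (y - x)))) =o[𝓝 x] fun y => y - x :=
    ((R.isBigO_comp _ _).trans_isLittleO ho1).neg_left.sub
      (((R.comp c).isBigO_comp _ _).trans_isLittleO ho2)
  refine HasFDerivAt.differentiableAt (f' := -(R.comp (c.comp (fderiv ℝ lam x) +
    D.comp (ContinuousLinearMap.inl ℝ (E d) (E p))))) (.of_isLittleO (ho3.congr_left fun y => ?_))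
  have e1 : D ((y, a y) - (x, a x)) = D.comp (ContinuousLinearMap.inl ℝ (E d) (E p)) (y - x) +
      Q (a y - a x) := by
    simp [hQ, ← map_add]
  rw [e1, gradA_eq_of_isMin hl hc (h y), gradA_eq_of_isMin hl hc (h x)]
  simp only [map_sub, map_add, map_neg, hRQ, neg_apply, ContinuousLinearMap.comp_apply, add_apply]
  abel

end Greedy

/-! ### Weighted energy estimate -/

/-- A consequence of the divergence theorem for a vector field with bounded Jacobian. -/
theorem integral_fderiv_apply_le {f : E d → ℝ} {b : E d → E d} {B : ℝ} (hf : Differentiable ℝ f)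
    (hf0 : ∀ x, 0 ≤ f x) (hb : Differentiable ℝ b) (hB : ∀ x, ‖fderiv ℝ b x‖ ≤ B)
    (hfi : Integrable f) (hfb : Integrable fun x => f x * ‖b x‖)
    (hfd : Integrable fun x => ‖fderiv ℝ f x‖ * ‖b x‖) :
    ∫ x, fderiv ℝ f x (b x) ≤ d * B * ∫ x, f x := by
  set e : Fin d → E d := fun i => EuclideanSpace.single i (1 : ℝ) with he
  have hen : ∀ i, ‖e i‖ = 1 := fun i => by simp [he]
  have hbi : ∀ i x, HasFDerivAt (fun x => b x i)
      ((EuclideanSpace.proj i : E d →L[ℝ] ℝ).comp (fderiv ℝ b x)) x := fun i x =>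
    (EuclideanSpace.proj i : E d →L[ℝ] ℝ).hasFDerivAt.comp x (hb x).hasFDerivAt
  have hbic : ∀ i, Continuous fun x => b x i := fun i =>
    continuous_iff_continuousAt.2 fun x => (hbi i x).continuousAt
  have hdb : ∀ i x, |fderiv ℝ (fun x => b x i) x (e i)| ≤ B := fun i x => by
    rw [(hbi i x).fderiv]
    calc _ ≤ ‖fderiv ℝ b x (e i)‖ := PiLp.norm_apply_le (fderiv ℝ b x (e i)) i
      _ ≤ B * ‖e i‖ := ContinuousLinearMap.le_of_opNorm_le _ (hB x) _
      _ = B := by rw [hen, mul_one]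
  have i1 : ∀ i, Integrable fun x => b x i * fderiv ℝ f x (e i) := fun i => by
    refine hfd.mono' ((hbic i).aestronglyMeasurable.mul
      (measurable_fderiv_apply_const ℝ f (e i)).aestronglyMeasurable)
      (Eventually.of_forall fun x => ?_)
    rw [norm_mul, mul_comm]
    gcongr
    · simpa [hen] using (fderiv ℝ f x).le_opNorm (e i)
    · exact PiLp.norm_apply_le (b x) i
  have i2 : ∀ i, Integrable fun x => fderiv ℝ (fun x => b x i) x (e i) * f x := fun i => by
    refine (hfi.const_mul B).mono'
      ((measurable_fderiv_apply_const ℝ _ (e i)).aestronglyMeasurable.mul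
        hf.continuous.aestronglyMeasurable) (Eventually.of_forall fun x => ?_)
    rw [norm_mul, Real.norm_of_nonneg (hf0 x)]
    exact mul_le_mul_of_nonneg_right (hdb i x) (hf0 x)
  have i3 : ∀ i, Integrable fun x => b x i * f x := fun i => by
    refine hfb.mono' ((hbic i).aestronglyMeasurable.mul hf.continuous.aestronglyMeasurable)
      (Eventually.of_forall fun x => ?_)
    rw [norm_mul, Real.norm_of_nonneg (hf0 x), mul_comm]
    exact mul_le_mul_of_nonneg_left (PiLp.norm_apply_le (b x) i) (hf0 x)
  have h1 : ∀ x, fderiv ℝ f x (b x) = ∑ i, b x i * fderiv ℝ f x (e i) := fun x =>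
    apply_eq_sum_single _ _
  simp only [h1]
  rw [integral_finsetSum _ fun i _ => i1 i]
  -- Integration by parts in each coordinate; every diagonal entry of `Db` is at least `-B`, whence
  -- the factor `d` after summation.
  have h2 : ∀ i ∈ Finset.univ, ∫ x, b x i * fderiv ℝ f x (e i) ≤ B * ∫ x, f x := fun i _ => by
    rw [integral_mul_fderiv_eq_neg_fderiv_mul_of_integrable (i2 i) (i1 i) (i3 i)
      (fun x _ => (hbi i x).differentiableAt) (fun x _ => hf x), ← integral_neg,
      ← integral_const_mul]
    refine integral_mono (i2 i).neg (hfi.const_mul B) fun x => ?_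
    have := (abs_le.1 (hdb i x)).1
    simp only
    nlinarith [hf0 x]
  refine (Finset.sum_le_sum h2).trans_eq ?_
  simp [mul_assoc]

/-- Weighted energy estimate for the transport equation. -/
theorem integral_sq_mul_le_of_transport {u R : E d → E n} {b : E d → E d} {W : E d → ℝ}
    {ρ Γ M Λ B κ₁ : ℝ} (hu : ContDiff ℝ 1 u) (hM : ∀ x, ‖u x‖ ≤ M * (1 + ‖x‖))
    (hΛ : ∀ x, ‖fderiv ℝ u x‖ ≤ Λ) (hb : Differentiable ℝ b) (hΓ : ∀ x, ‖b x‖ ≤ Γ * (1 + ‖x‖))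
    (hB : ∀ x, ‖fderiv ℝ b x‖ ≤ B) (pde : ∀ x, ρ • u x = fderiv ℝ u x (b x) + R x)
    (hW : Differentiable ℝ W) (hW0 : ∀ x, 0 < W x)
    (hDW : ∀ x, ‖fderiv ℝ W x‖ * (1 + ‖x‖) ≤ κ₁ * W x)
    (hWi₃ : Integrable fun x => (1 + ‖x‖) ^ 3 * W x) (hρ : (d * B + κ₁ * Γ) / 2 < ρ) :
    Integrable (fun x => ‖u x‖ ^ 2 * W x) ∧ Integrable (fun x => ‖R x‖ ^ 2 * W x) ∧
    (ρ - (d * B + κ₁ * Γ) / 2) ^ 2 * ∫ x, ‖u x‖ ^ 2 * W x ≤ ∫ x, ‖R x‖ ^ 2 * W x := by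
  set s := ρ - (d * B + κ₁ * Γ) / 2 with hs
  have hs0 : 0 < s := sub_pos.2 hρ
  have hM0 : 0 ≤ M := by simpa using (norm_nonneg _).trans (hM 0)
  have hΓ0 : 0 ≤ Γ := by simpa using (norm_nonneg _).trans (hΓ 0)
  have hΛ0 : 0 ≤ Λ := (norm_nonneg _).trans (hΛ 0)
  have hκ0 : 0 ≤ κ₁ := by
    have := (mul_nonneg (norm_nonneg _) (by positivity)).trans (hDW 0)
    exact nonneg_of_mul_nonneg_left this (hW0 0)
  have hud := hu.differentiable one_ne_zero
  have hWi : Integrable fun x => (1 + ‖x‖) ^ 2 * W x := by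
    refine hWi₃.mono' ?_ (Eventually.of_forall fun x => ?_)
    · exact (((continuous_const.add continuous_norm).pow 2).mul hW.continuous).aestronglyMeasurable
    · have hWx := hW0 x
      rw [Real.norm_of_nonneg (by positivity)]
      gcongr
      exacts [by simp, by norm_num]
  have hRc : Continuous R := by
    have : R = fun x => ρ • u x - fderiv ℝ u x (b x) := funext fun x => by rw [pde]; abel
    rw [this]
    exact (hu.continuous.const_smul ρ).sub
      ((hu.continuous_fderiv one_ne_zero).clm_apply hb.continuous)
  have hRb : ∀ x, ‖R x‖ ≤ (|ρ| * M + Λ * Γ) * (1 + ‖x‖) := fun x => by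
    have : R x = ρ • u x - fderiv ℝ u x (b x) := by rw [pde]; abel
    rw [this]
    refine (norm_sub_le _ _).trans ?_
    rw [norm_smul, Real.norm_eq_abs, add_mul, mul_assoc, mul_assoc]
    gcongr
    · exact hM x
    · exact (fderiv ℝ u x).le_of_opNorm_le_of_le (hΛ x) (hΓ x)
  have hfd : ∀ x, HasFDerivAt (fun x => ‖u x‖ ^ 2 * W x)
      (‖u x‖ ^ 2 • fderiv ℝ W x + W x • (2 • (innerSL ℝ (u x)).comp (fderiv ℝ u x))) x := fun x =>
    ((hud x).hasFDerivAt.norm_sq).mul (hW x).hasFDerivAt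
  have hfdiff : Differentiable ℝ fun x => ‖u x‖ ^ 2 * W x := fun x => (hfd x).differentiableAt
  have hu2 : ∀ x, ‖u x‖ ^ 2 ≤ M ^ 2 * (1 + ‖x‖) ^ 2 := fun x => by
    rw [← mul_pow]; have := hM x; gcongr
  have hDf : ∀ x, ‖fderiv ℝ (fun x => ‖u x‖ ^ 2 * W x) x‖ * (1 + ‖x‖) ≤
      (M ^ 2 * κ₁ + 2 * M * Λ) * ((1 + ‖x‖) ^ 2 * W x) := fun x => by
    have hx : 0 < 1 + ‖x‖ := by positivity
    have hWx := hW0 x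
    have h1 : ‖(2 : ℕ) • (innerSL ℝ (u x)).comp (fderiv ℝ u x)‖ ≤ 2 * (M * (1 + ‖x‖) * Λ) := by
      refine (norm_nsmul_le).trans ?_
      rw [Nat.cast_ofNat]
      gcongr
      refine (ContinuousLinearMap.opNorm_comp_le _ _).trans ?_
      rw [innerSL_apply_norm]
      gcongr
      exacts [hM x, hΛ x]
    rw [(hfd x).fderiv]
    calc _ ≤ (‖u x‖ ^ 2 * ‖fderiv ℝ W x‖ + W x * (2 * (M * (1 + ‖x‖) * Λ))) * (1 + ‖x‖) := by
          gcongr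
          refine (norm_add_le _ _).trans ?_
          rw [norm_smul, norm_smul, Real.norm_of_nonneg (sq_nonneg _), Real.norm_of_nonneg hWx.le]
          gcongr
      _ = ‖u x‖ ^ 2 * (‖fderiv ℝ W x‖ * (1 + ‖x‖)) + 2 * M * Λ * ((1 + ‖x‖) ^ 2 * W x) := by ring
      _ ≤ (M ^ 2 * (1 + ‖x‖) ^ 2) * (κ₁ * W x) + 2 * M * Λ * ((1 + ‖x‖) ^ 2 * W x) := by
          refine add_le_add_left (mul_le_mul (hu2 x) (hDW x) (by positivity) (by positivity)) _
      _ = _ := by ring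
  have i1 : Integrable fun x => ‖u x‖ ^ 2 * W x := by
    refine (hWi.const_mul (M ^ 2)).mono' hfdiff.continuous.aestronglyMeasurable
      (Eventually.of_forall fun x => ?_)
    have hWx := hW0 x
    rw [Real.norm_of_nonneg (by positivity), ← mul_assoc]
    exact mul_le_mul_of_nonneg_right (hu2 x) hWx.le
  have i2 : Integrable fun x => ‖R x‖ ^ 2 * W x := by
    refine (hWi.const_mul ((|ρ| * M + Λ * Γ) ^ 2)).mono'
      ((hRc.norm.pow 2).mul hW.continuous).aestronglyMeasurable
      (Eventually.of_forall fun x => ?_)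
    have hWx := hW0 x
    have := hRb x
    rw [Real.norm_of_nonneg (by positivity), ← mul_assoc, ← mul_pow]
    gcongr
  have i3 : Integrable fun x => ‖fderiv ℝ (fun x => ‖u x‖ ^ 2 * W x) x‖ * ‖b x‖ := by
    refine (hWi.const_mul (Γ * (M ^ 2 * κ₁ + 2 * M * Λ))).mono'
      ((measurable_fderiv ℝ _).norm.aestronglyMeasurable.mul
        hb.continuous.norm.aestronglyMeasurable) (Eventually.of_forall fun x => ?_)
    rw [Real.norm_of_nonneg (by positivity)]
    calc _ ≤ ‖fderiv ℝ (fun x => ‖u x‖ ^ 2 * W x) x‖ * (Γ * (1 + ‖x‖)) := by gcongr; exact hΓ x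
      _ = Γ * (‖fderiv ℝ (fun x => ‖u x‖ ^ 2 * W x) x‖ * (1 + ‖x‖)) := by ring
      _ ≤ _ := by
        rw [mul_assoc Γ]
        exact mul_le_mul_of_nonneg_left (hDf x) hΓ0
  have i4 : Integrable fun x => ‖u x‖ ^ 2 * W x * ‖b x‖ := by
    refine (hWi₃.const_mul (M ^ 2 * Γ)).mono'
      (hfdiff.continuous.mul hb.continuous.norm).aestronglyMeasurable
      (Eventually.of_forall fun x => ?_)
    have hWx := hW0 x
    rw [Real.norm_of_nonneg (by positivity)]
    calc _ ≤ (M ^ 2 * (1 + ‖x‖) ^ 2) * W x * (Γ * (1 + ‖x‖)) := by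
          gcongr
          exacts [hu2 x, hΓ x]
      _ = _ := by ring
  refine ⟨i1, i2, ?_⟩
  have h1 := integral_fderiv_apply_le hfdiff (fun x => mul_nonneg (sq_nonneg _) (hW0 x).le) hb hB
    i1 i4 i3
  have i5 : Integrable fun x => fderiv ℝ (fun x => ‖u x‖ ^ 2 * W x) x (b x) := by
    refine i3.mono' ?_ (Eventually.of_forall fun x => ContinuousLinearMap.le_opNorm _ _)
    have e : ∀ x, fderiv ℝ (fun x => ‖u x‖ ^ 2 * W x) x (b x) = _ := fun x =>
      apply_eq_sum_single _ _
    simp only [e]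
    refine (Finset.measurable_fun_sum _ fun i _ => Measurable.mul ?_
      (measurable_fderiv_apply_const ℝ _ _)).aestronglyMeasurable
    exact ((EuclideanSpace.proj i : E d →L[ℝ] ℝ).continuous.comp hb.continuous).measurable
  -- The equation is tested with `u W`. Young's inequality with parameter `s` splits `2 ⟨u, R⟩`.
  -- After the divergence term `d B` is subtracted as well, exactly `s` remains as the coefficient
  -- on the left.
  have h2 : ∫ x, (2 * ρ - κ₁ * Γ - s) * (‖u x‖ ^ 2 * W x) ≤
      ∫ x, (fderiv ℝ (fun x => ‖u x‖ ^ 2 * W x) x (b x) + s⁻¹ * (‖R x‖ ^ 2 * W x)) := by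
    refine integral_mono (i1.const_mul _) (i5.add (i2.const_mul _)) fun x => ?_
    have hWx := hW0 x
    simp only [(hfd x).fderiv]
    have e1 : fderiv ℝ u x (b x) = ρ • u x - R x := by rw [pde]; abel
    have e2 : -(κ₁ * Γ * W x) ≤ fderiv ℝ W x (b x) := by
      refine (abs_le.1 ?_).1
      calc _ ≤ ‖fderiv ℝ W x‖ * (Γ * (1 + ‖x‖)) :=
            (fderiv ℝ W x).le_opNorm_of_le (hΓ x)
        _ = Γ * (‖fderiv ℝ W x‖ * (1 + ‖x‖)) := by ring
        _ ≤ Γ * (κ₁ * W x) := mul_le_mul_of_nonneg_left (hDW x) hΓ0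
        _ = _ := by ring
    have e3 : 2 * inner ℝ (u x) (R x) ≤ s * ‖u x‖ ^ 2 + s⁻¹ * ‖R x‖ ^ 2 := by
      have h3 := real_inner_le_norm (u x) (R x)
      have h4 : 0 ≤ s⁻¹ * (s * ‖u x‖ - ‖R x‖) ^ 2 := by positivity
      have h5 : s⁻¹ * (s * ‖u x‖ - ‖R x‖) ^ 2 =
          s * ‖u x‖ ^ 2 + s⁻¹ * ‖R x‖ ^ 2 - 2 * (‖u x‖ * ‖R x‖) := by
        field_simp
        ring
      linarith
    have e4 : (‖u x‖ ^ 2 • fderiv ℝ W x + W x • (2 • (innerSL ℝ (u x)).comp (fderiv ℝ u x))) (b x)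
        = ‖u x‖ ^ 2 * fderiv ℝ W x (b x) +
          W x * (2 * (ρ * ‖u x‖ ^ 2 - inner ℝ (u x) (R x))) := by
      simp [e1, inner_sub_right, inner_smul_right]
    rw [e4]
    have e5 := mul_le_mul_of_nonneg_left e2 (sq_nonneg ‖u x‖)
    have e6 := mul_le_mul_of_nonneg_left e3 hWx.le
    nlinarith
  rw [integral_add i5 (i2.const_mul _), integral_const_mul, integral_const_mul] at h2
  have h3 : s * ∫ x, ‖u x‖ ^ 2 * W x ≤ s⁻¹ * ∫ x, ‖R x‖ ^ 2 * W x := by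
    have : 2 * ρ - κ₁ * Γ - s - d * B = s := by rw [hs]; ring
    set I := ∫ x, ‖u x‖ ^ 2 * W x
    have h4 : (2 * ρ - κ₁ * Γ - s) * I = s * I + d * B * I := by rw [← add_mul, ← this]; ring
    linarith
  calc s ^ 2 * ∫ x, ‖u x‖ ^ 2 * W x = s * (s * ∫ x, ‖u x‖ ^ 2 * W x) := by ring
    _ ≤ s * (s⁻¹ * ∫ x, ‖R x‖ ^ 2 * W x) := by gcongr
    _ = _ := by field_simp

/-- The weight `(1 + ‖x‖²) ^ (-2α)`, with additional decay at infinity. -/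
noncomputable def dampedWeight (α ε : ℝ) (x : E d) : ℝ :=
  ((1 + ‖x‖ ^ 2) ^ (2 * α) * (1 + ε * ‖x‖ ^ 2) ^ (d + 3))⁻¹

theorem weight_pos (α : ℝ) (x : E d) : 0 < weight α x := by
  unfold weight
  positivity

theorem dampedWeight_pos (α : ℝ) {ε : ℝ} (hε : 0 ≤ ε) (x : E d) : 0 < dampedWeight α ε x := by
  unfold dampedWeight
  positivity

theorem dampedWeight_le (α : ℝ) {ε : ℝ} (hε : 0 ≤ ε) (x : E d) :
    dampedWeight α ε x ≤ weight α x := by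
  unfold dampedWeight weight
  have h1 : 0 ≤ ε * ‖x‖ ^ 2 := by positivity
  refine inv_anti₀ (by positivity) ?_
  refine le_mul_of_one_le_right (by positivity) (one_le_pow₀ (by linarith))

/-- Of the `d + 3` damping factors, two absorb the cubic growth, by `(1 + ‖x‖)³ ≤ 4 (1 + ‖x‖²)²`,
and the remaining `d + 1` make the function integrable for any `α ≥ 0`. -/
theorem integrable_dampedWeight {α ε : ℝ} (hα : 0 ≤ α) (hε : 0 < ε) (hε1 : ε ≤ 1) :
    Integrable fun x : E d => (1 + ‖x‖) ^ 3 * dampedWeight α ε x := by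
  have h := (integrable_rpow_neg_one_add_norm_sq (E := E d) (μ := volume)
    (r := 2 * (d + 1)) (by simp; linarith [(d.cast_nonneg : (0 : ℝ) ≤ d)])).const_mul
    (4 * (ε ^ (d + 3))⁻¹)
  refine h.mono' ?_ (Eventually.of_forall fun x => ?_)
  · unfold dampedWeight
    exact Measurable.aestronglyMeasurable (by fun_prop)
  · have hs : 1 ≤ 1 + ‖x‖ ^ 2 := by nlinarith [sq_nonneg ‖x‖]
    have e0 : (1 + ‖x‖ ^ 2 : ℝ) ^ (-(2 * ((d : ℝ) + 1)) / 2) = ((1 + ‖x‖ ^ 2) ^ (d + 1))⁻¹ := by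
      rw [← Real.rpow_natCast _ (d + 1), ← Real.rpow_neg (by positivity)]
      congr 1
      push_cast
      ring
    have e1 : (1 + ‖x‖) ^ 3 ≤ 4 * (1 + ‖x‖ ^ 2) ^ 2 := by
      have h1 : (1 + ‖x‖) ^ 2 ≤ 2 * (1 + ‖x‖ ^ 2) := by nlinarith [sq_nonneg (‖x‖ - 1)]
      calc (1 + ‖x‖) ^ 3 ≤ (1 + ‖x‖) ^ 4 := by gcongr <;> simp
        _ = ((1 + ‖x‖) ^ 2) ^ 2 := by ring
        _ ≤ (2 * (1 + ‖x‖ ^ 2)) ^ 2 := by gcongr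
        _ = _ := by ring
    have e2 : ε * (1 + ‖x‖ ^ 2) ≤ 1 + ε * ‖x‖ ^ 2 := by linarith
    have e3 : 1 ≤ (1 + ‖x‖ ^ 2) ^ (2 * α) := Real.one_le_rpow hs (by positivity)
    have e4 := dampedWeight_pos α hε.le x
    rw [Real.norm_of_nonneg (by positivity), e0]
    have e5 : dampedWeight α ε x ≤ (1 * (ε * (1 + ‖x‖ ^ 2)) ^ (d + 3))⁻¹ := by
      unfold dampedWeight
      gcongr
    calc _ ≤ 4 * (1 + ‖x‖ ^ 2) ^ 2 * (1 * (ε * (1 + ‖x‖ ^ 2)) ^ (d + 3))⁻¹ := by gcongr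
      _ = _ := by
        rw [mul_pow, pow_add (1 + ‖x‖ ^ 2) (d + 1) 2]
        field_simp

/-- Logarithmic derivative: the power `2α` contributes `8α` and each of the `d + 3` damping factors
contributes 4. The bound does not depend on `ε`, so the energy estimate survives the removal of the
damping. -/
theorem dampedWeight_deriv {α ε : ℝ} (hα : 0 ≤ α) (hε : 0 < ε) (hε1 : ε ≤ 1) (x : E d) :
    DifferentiableAt ℝ (dampedWeight α ε) x ∧
      ‖fderiv ℝ (dampedWeight α ε) x‖ * (1 + ‖x‖) ≤
        (8 * α + 4 * (d + 3)) * dampedWeight α ε x := by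
  have hs : 0 < 1 + ‖x‖ ^ 2 := by positivity
  have ht : 0 < 1 + ε * ‖x‖ ^ 2 := by positivity
  have h1 : HasFDerivAt (fun x : E d => (1 + ‖x‖ ^ 2) ^ (2 * α))
      ((2 * α * (1 + ‖x‖ ^ 2) ^ (2 * α - 1)) • (2 : ℝ) • innerSL ℝ x) x :=
    ((hasFDerivAt_norm_sq_id x).const_add 1).rpow_const (Or.inl hs.ne')
  have h2 : HasFDerivAt (fun x : E d => (1 + ε * ‖x‖ ^ 2) ^ (d + 3))
      (((d + 3) • (1 + ε * ‖x‖ ^ 2) ^ (d + 3 - 1)) • ε • (2 : ℝ) • innerSL ℝ x) x :=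
    (((hasFDerivAt_norm_sq_id x).const_mul ε).const_add 1).pow (d + 3)
  have h3 := h1.mul h2
  have hQ : (1 + ‖x‖ ^ 2) ^ (2 * α) * (1 + ε * ‖x‖ ^ 2) ^ (d + 3) ≠ 0 := by positivity
  have h4 := (hasDerivAt_inv hQ).comp_hasFDerivAt x h3
  refine ⟨h4.differentiableAt, ?_⟩
  have h5 : fderiv ℝ (dampedWeight α ε) x = _ := h4.fderiv
  rw [h5, norm_smul]
  set P := (1 + ‖x‖ ^ 2) ^ (2 * α) with hP
  have hP0 : 0 < P := by positivity
  have hP' : (1 + ‖x‖ ^ 2) ^ (2 * α - 1) = P / (1 + ‖x‖ ^ 2) := by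
    rw [Real.rpow_sub_one hs.ne']
  set T := (1 + ε * ‖x‖ ^ 2) ^ (d + 2) with hT
  have hT0 : 0 < T := by positivity
  have hT' : (1 + ε * ‖x‖ ^ 2) ^ (d + 3) = T * (1 + ε * ‖x‖ ^ 2) := pow_succ _ _
  have hin : ‖(2 : ℝ) • innerSL ℝ x‖ = 2 * ‖x‖ := by
    rw [norm_smul, innerSL_apply_norm]; simp
  have e1 : ‖x‖ * (1 + ‖x‖) ≤ 2 * (1 + ‖x‖ ^ 2) := by nlinarith [sq_nonneg (‖x‖ - 1)]
  have e2 : ε * ‖x‖ * (1 + ‖x‖) ≤ 2 * (1 + ε * ‖x‖ ^ 2) := by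
    nlinarith [mul_nonneg hε.le (sq_nonneg (‖x‖ - 1)), mul_nonneg hε.le (sq_nonneg ‖x‖)]
  have key : ‖P • ((d + 3) • (1 + ε * ‖x‖ ^ 2) ^ (d + 3 - 1)) • ε • (2 : ℝ) • innerSL ℝ x +
      (1 + ε * ‖x‖ ^ 2) ^ (d + 3) • (2 * α * (1 + ‖x‖ ^ 2) ^ (2 * α - 1)) • (2 : ℝ) • innerSL ℝ x‖
      * (1 + ‖x‖) ≤ (8 * α + 4 * (d + 3)) * (P * (1 + ε * ‖x‖ ^ 2) ^ (d + 3)) := by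
    calc _ ≤ (P * (((d : ℝ) + 3) * T * (ε * (2 * ‖x‖))) +
          T * (1 + ε * ‖x‖ ^ 2) * (2 * α * (P / (1 + ‖x‖ ^ 2)) * (2 * ‖x‖))) * (1 + ‖x‖) := by
          gcongr
          refine (norm_add_le _ _).trans (le_of_eq ?_)
          rw [norm_smul P, norm_smul (_ • _), norm_smul ε, norm_smul (_ ^ _), norm_smul (_ * _),
            hin, hP', hT', nsmul_eq_mul]
          have : (1 + ε * ‖x‖ ^ 2) ^ (d + 3 - 1) = T := rfl
          rw [this, Real.norm_of_nonneg hP0.le, Real.norm_of_nonneg (by positivity),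
            Real.norm_of_nonneg hε.le, Real.norm_of_nonneg (by positivity),
            Real.norm_of_nonneg (by positivity)]
          push_cast
          ring
      _ = 2 * ((d : ℝ) + 3) * P * T * (ε * ‖x‖ * (1 + ‖x‖)) +
          4 * α * P * T * (1 + ε * ‖x‖ ^ 2) * (‖x‖ * (1 + ‖x‖) / (1 + ‖x‖ ^ 2)) := by
          field_simp
          ring
      _ ≤ 2 * ((d : ℝ) + 3) * P * T * (2 * (1 + ε * ‖x‖ ^ 2)) +
          4 * α * P * T * (1 + ε * ‖x‖ ^ 2) * 2 := by
          gcongr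
          rwa [div_le_iff₀ hs]
      _ = _ := by rw [hT']; ring
  have hD : dampedWeight α ε x = (P * (1 + ε * ‖x‖ ^ 2) ^ (d + 3))⁻¹ := rfl
  rw [hD]
  set Q := P * (1 + ε * ‖x‖ ^ 2) ^ (d + 3) with hQdef
  have hQ0 : 0 < Q := by positivity
  rw [norm_neg, norm_inv, norm_pow, Real.norm_of_nonneg hQ0.le, mul_assoc]
  calc _ ≤ (Q ^ 2)⁻¹ * ((8 * α + 4 * (d + 3)) * Q) := by gcongr
    _ = _ := by field_simp

/-- Weighted `L²` estimate for the transport equation. -/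
theorem sqNorm_le_of_transport {u R : E d → E n} {b : E d → E d} {α ρ Γ M Λ B : ℝ} (hα : 0 ≤ α)
    (hu : ContDiff ℝ 1 u) (hM : ∀ x, ‖u x‖ ≤ M * (1 + ‖x‖))
    (hΛ : ∀ x, ‖fderiv ℝ u x‖ ≤ Λ) (hb : Differentiable ℝ b) (hΓ : ∀ x, ‖b x‖ ≤ Γ * (1 + ‖x‖))
    (hB : ∀ x, ‖fderiv ℝ b x‖ ≤ B) (pde : ∀ x, ρ • u x = fderiv ℝ u x (b x) + R x)
    (hρ : (d * B + (8 * α + 4 * (d + 3)) * Γ) / 2 < ρ) :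
    ENNReal.ofReal ((ρ - (d * B + (8 * α + 4 * (d + 3)) * Γ) / 2) ^ 2) * sqNorm α u
      ≤ sqNorm α R := by
  set s := ρ - (d * B + (8 * α + 4 * (d + 3)) * Γ) / 2 with hs
  let ε : ℕ → ℝ := fun k => 1 / ((k : ℝ) + 1)
  have hε : ∀ k, 0 < ε k := fun k => by positivity
  have hε1 : ∀ k, ε k ≤ 1 := fun k => by
    refine (div_le_one (by positivity)).2 ?_
    linarith [(k.cast_nonneg : (0 : ℝ) ≤ k)]
  have hstep : ∀ k, ∫⁻ x, ENNReal.ofReal (s ^ 2 * (‖u x‖ ^ 2 * dampedWeight α (ε k) x))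
      ≤ sqNorm α R := fun k => by
    obtain ⟨i1, i2, h⟩ := integral_sq_mul_le_of_transport hu hM hΛ hb hΓ hB pde
      (fun x => (dampedWeight_deriv hα (hε k) (hε1 k) x).1)
      (dampedWeight_pos α (hε k).le)
      (fun x => (dampedWeight_deriv hα (hε k) (hε1 k) x).2)
      (integrable_dampedWeight hα (hε k) (hε1 k)) hρ
    have hnn := fun x => (dampedWeight_pos (d := d) α (hε k).le x).le
    rw [← integral_const_mul] at h
    rw [← ofReal_integral_eq_lintegral_ofReal (i1.const_mul _)
      (Eventually.of_forall fun x => mul_nonneg (sq_nonneg _) (mul_nonneg (sq_nonneg _) (hnn x)))]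
    refine (ENNReal.ofReal_le_ofReal h).trans ?_
    rw [ofReal_integral_eq_lintegral_ofReal i2
      (Eventually.of_forall fun x => mul_nonneg (sq_nonneg _) (hnn x)), sqNorm]
    exact lintegral_mono fun x => ENNReal.ofReal_le_ofReal
      (mul_le_mul_of_nonneg_left (dampedWeight_le α (hε k).le x) (sq_nonneg _))
  have hmeas : ∀ k, Measurable fun x => ENNReal.ofReal
      (s ^ 2 * (‖u x‖ ^ 2 * dampedWeight α (ε k) x)) := fun k => by
    have := hu.continuous.measurable
    unfold dampedWeight
    fun_prop
  have hlim : ∀ x : E d, Tendsto (fun k => ENNReal.ofReal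
      (s ^ 2 * (‖u x‖ ^ 2 * dampedWeight α (ε k) x))) atTop
      (𝓝 (ENNReal.ofReal (s ^ 2 * (‖u x‖ ^ 2 * weight α x)))) := fun x => by
    refine ENNReal.tendsto_ofReal (Tendsto.const_mul _ (Tendsto.const_mul _ ?_))
    have hε0 : Tendsto ε atTop (𝓝 0) := tendsto_one_div_add_atTop_nhds_zero_nat
    unfold dampedWeight weight
    refine Tendsto.inv₀ ?_ (by positivity)
    have h1 := (((hε0.mul_const (‖x‖ ^ 2)).const_add 1).pow (d + 3)).const_mul
      ((1 + ‖x‖ ^ 2) ^ (2 * α))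
    simpa using h1
  -- Fatou's lemma removes the damping. Finiteness of the norm of `u` is thus a conclusion when `R`
  -- has finite norm, and need not be known beforehand.
  have hfatou := (lintegral_liminf_le hmeas (μ := volume)).trans
    (liminf_le_of_frequently_le' (f := (atTop : Filter ℕ)) (Eventually.of_forall hstep).frequently)
  simp only [fun x => (hlim x).liminf_eq] at hfatou
  refine le_trans (le_of_eq ?_) hfatou
  rw [sqNorm, ← lintegral_const_mul' _ _ ENNReal.ofReal_ne_top]
  exact lintegral_congr fun x => (ENNReal.ofReal_mul (sq_nonneg _)).symm

/-! ### Estimates for a single iteration step -/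

/-- The source term `(D_x g)ᵀ u + ∇_x l` of the linear system for the next iterate. -/
noncomputable def source (g : E d → E p → E d) (l : E d → E p → ℝ) (u : E d → E d)
    (w : E d → E p) (x : E d) : E d :=
  ContinuousLinearMap.adjoint (Dx g x (w x)) (u x) + gradX l x (w x)

theorem norm_fderiv_le_of_norm_sub_le {u : E d → E n} {L : ℝ} (hL : 0 ≤ L)
    (h : ∀ x y, ‖u x - u y‖ ≤ L * ‖x - y‖) (x : E d) : ‖fderiv ℝ u x‖ ≤ L :=
  norm_fderiv_le_of_lip' ℝ hL (Eventually.of_forall fun y => h y x)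

theorem norm_sub_le_of_norm_fderiv_le {u : E d → E n} {L : ℝ} (hu : Differentiable ℝ u)
    (h : ∀ x, ‖fderiv ℝ u x‖ ≤ L) (x y : E d) : ‖u x - u y‖ ≤ L * ‖x - y‖ :=
  convex_univ.norm_image_sub_le_of_norm_fderiv_le (𝕜 := ℝ) (fun x _ => hu x)
    (fun x _ => h x) trivial trivial

section

variable {C : Constants} {g : E d → E p → E d} {l : E d → E p → ℝ}

theorem norm_source_le (hg : AssumptionDynamics C g) (hl : AssumptionCost C l) {u : E d → E d}
    {w : E d → E p} {L A : ℝ} (hu : ∀ x, ‖u x‖ ≤ L * (1 + ‖x‖)) (hw : ∀ x, ‖w x‖ ≤ A * (1 + ‖x‖))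
    (x : E d) : ‖source g l u w x‖ ≤ (C.gb * L + C.lb * (2 + A)) * (1 + ‖x‖) := by
  have h1 := (hg.norm_adjoint_Dx_le x (u x) (w x)).trans
    (mul_le_mul_of_nonneg_left (hu x) C.gb_pos.le)
  have h2 : ‖gradX l x (w x)‖ ≤ C.lb * ((2 + A) * (1 + ‖x‖)) :=
    (hl.norm_gradX_le x (w x)).trans
      (mul_le_mul_of_nonneg_left (by linarith [hw x, norm_nonneg x]) C.lb_pos.le)
  exact (norm_add_le_of_le h1 h2).trans_eq (by ring)

theorem norm_source_sub_le (hg : AssumptionDynamics C g) (hl : AssumptionCost C l) {u : E d → E d}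
    {w : E d → E p} {L Λ : ℝ} (hud : Differentiable ℝ u) (hu : ∀ x, ‖u x‖ ≤ L * (1 + ‖x‖))
    (hu' : ∀ x, ‖fderiv ℝ u x‖ ≤ L) (hw : ∀ x y, ‖w x - w y‖ ≤ Λ * ‖x - y‖) (x y : E d) :
    ‖source g l u w x - source g l u w y‖ ≤
      (C.g2 * L + C.gb * L + C.l2 * (1 + Λ)) * ‖x - y‖ := by
  have h1 := hg.norm_adjoint_Dx_sub_le hud hu hu' x y
  have h2 : ‖gradX l x (w x) - gradX l y (w y)‖ ≤ C.l2 * ((1 + Λ) * ‖x - y‖) :=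
    (hl.norm_gradX_sub_le x y _ _).trans
      (mul_le_mul_of_nonneg_left (by linarith [hw x y]) C.l2_pos.le)
  simp only [source]
  rw [add_sub_add_comm, hg.Dx_eq, hg.Dx_eq y]
  exact (norm_add_le_of_le h1 h2).trans_eq (by ring)

theorem norm_dynamics_le (hg : AssumptionDynamics C g) {w : E d → E p} {A : ℝ}
    (hw : ∀ x, ‖w x‖ ≤ A * (1 + ‖x‖)) (x : E d) :
    ‖g x (w x)‖ ≤ C.gb * (1 + A) * (1 + ‖x‖) := by
  refine (hg.growth x (w x)).trans ?_
  rw [mul_assoc]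
  exact mul_le_mul_of_nonneg_left (by linarith [hw x]) C.gb_pos.le

theorem norm_dynamics_sub_le (hg : AssumptionDynamics C g) {w : E d → E p} {Λ : ℝ}
    (hw : ∀ x y, ‖w x - w y‖ ≤ Λ * ‖x - y‖) (x y : E d) :
    ‖g x (w x) - g y (w y)‖ ≤ (C.gb + C.cb * Λ) * ‖x - y‖ := by
  refine (hg.norm_sub_le _ _ _ _).trans ?_
  have := mul_le_mul_of_nonneg_left (hw x y) hg.cb_nonneg
  linarith

theorem norm_greedy_le (hg : AssumptionDynamics C g) (hl : AssumptionCost C l) {u : E d → E d}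
    {w : E d → E p} {L : ℝ} (h : IsGreedy g l u w) (hu : ∀ x, ‖u x‖ ≤ L * (1 + ‖x‖)) (x : E d) :
    ‖w x‖ ≤ (C.c0 + C.cb * L) / C.l1 * (1 + ‖x‖) := by
  have h1 := norm_le_of_isMin hg hl (h x)
  have h2 := mul_le_mul_of_nonneg_left (hu x) hg.cb_nonneg
  rw [div_mul_eq_mul_div, le_div_iff₀ C.l1_pos]
  nlinarith [mul_nonneg C.c0_pos.le (norm_nonneg x)]

theorem norm_greedy_sub_le (hg : AssumptionDynamics C g) (hl : AssumptionCost C l) {u : E d → E d}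
    {w : E d → E p} {L : ℝ} (h : IsGreedy g l u w) (hu : ∀ x y, ‖u x - u y‖ ≤ L * ‖x - y‖)
    (x y : E d) : ‖w x - w y‖ ≤ (C.cb * L + C.l2) / C.cs * ‖x - y‖ := by
  have h1 := norm_sub_le_of_isMin hg hl (h x) (h y)
  have h2 := mul_le_mul_of_nonneg_left (hu x y) hg.cb_nonneg
  rw [div_mul_eq_mul_div, le_div_iff₀ C.cs_pos]
  linarith

theorem norm_greedy_sub_greedy_le (hg : AssumptionDynamics C g) (hl : AssumptionCost C l)
    {u u' : E d → E d} {w w' : E d → E p} (h : IsGreedy g l u w) (h' : IsGreedy g l u' w')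
    (x : E d) : ‖w x - w' x‖ ≤ C.cb / C.cs * ‖u x - u' x‖ := by
  have h1 := norm_sub_le_of_isMin hg hl (h x) (h' x)
  rw [div_mul_eq_mul_div, le_div_iff₀ C.cs_pos]
  simp only [sub_self, norm_zero, mul_zero, add_zero] at h1
  linarith

/-- The residual of the difference of two solutions of the linear system, transported by
the first dynamics. -/
theorem norm_residual_le (hg : AssumptionDynamics C g) (hl : AssumptionCost C l) {ρ L : ℝ}
    {u u₁ v v₁ : E d → E d} {w w₁ : E d → E p} {x : E d} (hv : DifferentiableAt ℝ v x)
    (hv₁ : DifferentiableAt ℝ v₁ x) (hL : ‖fderiv ℝ v₁ x‖ ≤ L)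
    (pde : ρ • v x = fderiv ℝ v x (g x (w x)) + source g l u w x)
    (pde₁ : ρ • v₁ x = fderiv ℝ v₁ x (g x (w₁ x)) + source g l u₁ w₁ x) :
    ‖ρ • (v x - v₁ x) - fderiv ℝ (fun x => v x - v₁ x) x (g x (w x))‖ ≤
      C.gb * ‖u x - u₁ x‖ + (C.l2 + L * C.cb) * ‖w x - w₁ x‖ := by
  -- Replacing the drift of `v₁` by that of `v` costs `Dv₁` applied to the difference of the drifts.
  -- Only the gradient of `v₁` needs a bound, so `v` may later be a classical solution about whose
  -- gradient nothing quantitative is known.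
  have e : ρ • (v x - v₁ x) - fderiv ℝ (fun x => v x - v₁ x) x (g x (w x)) =
      ContinuousLinearMap.adjoint (Dx g x 0) (u x - u₁ x) +
      ((gradX l x (w x) - gradX l x (w₁ x)) +
      fderiv ℝ v₁ x (g x (w x) - g x (w₁ x))) := by
    rw [fderiv_fun_sub hv hv₁, smul_sub, pde, pde₁]
    simp only [source, sub_apply, map_sub, hg.Dx_eq x (w x), hg.Dx_eq x (w₁ x)]
    abel
  have h1 := hg.norm_adjoint_Dx_le x (u x - u₁ x) 0
  have h2 := hl.norm_gradX_sub_le x x (w x) (w₁ x)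
  have h3 : ‖fderiv ℝ v₁ x (g x (w x) - g x (w₁ x))‖ ≤ L * (C.cb * ‖w x - w₁ x‖) :=
    (fderiv ℝ v₁ x).le_of_opNorm_le_of_le hL (hg.sub_eq_le _ _ _)
  rw [sub_self, norm_zero, zero_add] at h2
  rw [e]
  exact (norm_add_le_of_le h1 (norm_add_le_of_le h2 h3)).trans_eq (by ring)

end

/-! ### Constants and the threshold for the discount rate -/

/-- Common bound for the growth and for the Lipschitz constant of the iterates. -/
noncomputable def stateBound (K : ℝ) : ℝ := |K| + 1

/-- Growth constant of the policies. -/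
noncomputable def policyBound (C : Constants) (K : ℝ) : ℝ :=
  |K| + (C.c0 + |C.cb| * stateBound K) / C.l1

/-- Lipschitz constant of the policies. -/
noncomputable def policyLip (C : Constants) (K : ℝ) : ℝ :=
  |K| + (|C.cb| * stateBound K + C.l2) / C.cs

/-- Growth constant of the closed loop dynamics. -/
noncomputable def flowBound (C : Constants) (K : ℝ) : ℝ := C.gb * (1 + policyBound C K)

/-- Lipschitz constant of the closed loop dynamics. -/
noncomputable def flowLip (C : Constants) (K : ℝ) : ℝ := C.gb + |C.cb| * policyLip C K

/-- Growth constant of the source terms. -/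
noncomputable def sourceBound (C : Constants) (K : ℝ) : ℝ :=
  C.gb * stateBound K + C.lb * (2 + policyBound C K)

/-- Lipschitz constant of the source terms. -/
noncomputable def sourceLip (C : Constants) (K : ℝ) : ℝ :=
  C.g2 * stateBound K + C.gb * stateBound K + C.l2 * (1 + policyLip C K)

/-- Bound of the residual of one policy iteration step, relative to the previous increment. -/
noncomputable def residualBound (C : Constants) (K : ℝ) : ℝ :=
  C.gb + (C.l2 + stateBound K * |C.cb|) * (|C.cb| / C.cs)

/-- Growth rate of the `L²_α` norm under the closed loop dynamics. -/
noncomputable def energyRate (C : Constants) (K α : ℝ) (d : ℕ) : ℝ :=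
  (d * flowLip C K + (8 * α + 4 * (d + 3)) * flowBound C K) / 2

/-- Discount rates for which PI-lambda is shown to contract. -/
structure IsLargeRate (C : Constants) (K α : ℝ) (d m : ℕ) (ρ : ℝ) : Prop where
  growth : 2 * flowBound C K * (1 + m) + 2 * sourceBound C K < ρ
  lipschitz : flowLip C K + 4 * flowBound C K + sourceLip C K < ρ
  contraction : 4 * flowBound C K + 4 * residualBound C K < ρ
  energy : energyRate C K α d + 2 * residualBound C K < ρ

/-- The bounds on the iterates are fixed in terms of `K` and the constants before `ρ` is chosen, so
all four conditions are lower bounds on `ρ` that do not involve `g`, `l` or the iterates. -/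
theorem exists_isLargeRate (C : Constants) (K α : ℝ) (d m : ℕ) :
    ∃ ρ₂, ∀ ρ, ρ₂ < ρ → IsLargeRate C K α d m ρ := by
  refine ⟨max (max (2 * flowBound C K * (1 + m) + 2 * sourceBound C K)
    (flowLip C K + 4 * flowBound C K + sourceLip C K))
    (max (4 * flowBound C K + 4 * residualBound C K)
    (energyRate C K α d + 2 * residualBound C K)), fun ρ h => ?_⟩
  simp only [max_lt_iff] at h
  exact ⟨h.1.1, h.1.2, h.2.1, h.2.2⟩

section

variable (C : Constants) (K : ℝ)

theorem one_le_stateBound : 1 ≤ stateBound K := by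
  unfold stateBound
  linarith [abs_nonneg K]

theorem policyBound_nonneg : 0 ≤ policyBound C K := by
  have := one_le_stateBound K
  have := C.c0_pos
  have := C.l1_pos
  unfold policyBound
  positivity

theorem policyLip_nonneg : 0 ≤ policyLip C K := by
  have := one_le_stateBound K
  have := C.l2_pos
  have := C.cs_pos
  unfold policyLip
  positivity

theorem flowBound_nonneg : 0 ≤ flowBound C K := by
  have := policyBound_nonneg C K
  have := C.gb_pos
  unfold flowBound
  positivity

theorem flowLip_nonneg : 0 ≤ flowLip C K := by
  have := policyLip_nonneg C K
  have := C.gb_pos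
  unfold flowLip
  positivity

theorem sourceBound_nonneg : 0 ≤ sourceBound C K := by
  have := policyBound_nonneg C K
  have := one_le_stateBound K
  have := C.gb_pos
  have := C.lb_pos
  unfold sourceBound
  positivity

theorem sourceLip_nonneg : 0 ≤ sourceLip C K := by
  have := policyLip_nonneg C K
  have := one_le_stateBound K
  have := C.gb_pos
  have := C.g2_pos
  have := C.l2_pos
  unfold sourceLip
  positivity

theorem residualBound_pos : 0 < residualBound C K := by
  have := one_le_stateBound K
  have := C.gb_pos
  have := C.l2_pos
  have := C.cs_pos
  unfold residualBound
  positivity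

end

/-! ### Bounds uniform in the iteration -/

/-- The uniform bounds satisfied by all iterates. -/
structure UniformBounds (C : Constants) (K : ℝ) (u : E d → E d) (w : E d → E p) : Prop where
  differentiable : Differentiable ℝ u
  growth : ∀ x, ‖u x‖ ≤ stateBound K * (1 + ‖x‖)
  deriv_le : ∀ x, ‖fderiv ℝ u x‖ ≤ stateBound K
  policy_growth : ∀ x, ‖w x‖ ≤ policyBound C K * (1 + ‖x‖)
  policy_lip : ∀ x y, ‖w x - w y‖ ≤ policyLip C K * ‖x - y‖

section

variable {C : Constants} {K : ℝ} {g : E d → E p → E d} {l : E d → E p → ℝ} {u : E d → E d}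
  {w : E d → E p}

theorem UniformBounds.flow_growth (h : UniformBounds C K u w) (hg : AssumptionDynamics C g)
    (x : E d) : ‖g x (w x)‖ ≤ flowBound C K * (1 + ‖x‖) :=
  norm_dynamics_le hg h.policy_growth x

theorem UniformBounds.flow_lip (h : UniformBounds C K u w) (hg : AssumptionDynamics C g)
    (x y : E d) : ‖g x (w x) - g y (w y)‖ ≤ flowLip C K * ‖x - y‖ := by
  -- The constants contain `|cb|` because `cb` is known to be nonnegative only once some `g` with
  -- `‖c‖ = cb` is given.
  rw [flowLip, abs_of_nonneg hg.cb_nonneg]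
  exact norm_dynamics_sub_le hg h.policy_lip x y

theorem UniformBounds.source_growth (h : UniformBounds C K u w) (hg : AssumptionDynamics C g)
    (hl : AssumptionCost C l) (x : E d) : ‖source g l u w x‖ ≤ sourceBound C K * (1 + ‖x‖) :=
  norm_source_le hg hl h.growth h.policy_growth x

theorem UniformBounds.source_lip (h : UniformBounds C K u w) (hg : AssumptionDynamics C g)
    (hl : AssumptionCost C l) (x y : E d) :
    ‖source g l u w x - source g l u w y‖ ≤ sourceLip C K * ‖x - y‖ :=
  norm_source_sub_le hg hl h.differentiable h.growth h.deriv_le h.policy_lip x y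

theorem norm_greedy_le_policyBound (hg : AssumptionDynamics C g) (hl : AssumptionCost C l)
    (h : IsGreedy g l u w) (hu : ∀ x, ‖u x‖ ≤ stateBound K * (1 + ‖x‖)) (x : E d) :
    ‖w x‖ ≤ policyBound C K * (1 + ‖x‖) := by
  refine (norm_greedy_le hg hl h hu x).trans ?_
  rw [policyBound, abs_of_nonneg hg.cb_nonneg]
  gcongr
  linarith [abs_nonneg K]

theorem uniformBounds_of_greedy (hg : AssumptionDynamics C g) (hl : AssumptionCost C l)
    (h : IsGreedy g l u w) (hd : Differentiable ℝ u) (hu : ∀ x, ‖u x‖ ≤ stateBound K * (1 + ‖x‖))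
    (hu' : ∀ x, ‖fderiv ℝ u x‖ ≤ stateBound K) : UniformBounds C K u w where
  differentiable := hd
  growth := hu
  deriv_le := hu'
  policy_growth := norm_greedy_le_policyBound hg hl h hu
  policy_lip x y := by
    refine (norm_greedy_sub_le hg hl h (norm_sub_le_of_norm_fderiv_le hd hu') x y).trans ?_
    rw [policyLip, abs_of_nonneg hg.cb_nonneg]
    gcongr
    linarith [abs_nonneg K]

variable {α ρ : ℝ} {m : ℕ}

/-- The bounds propagate through the linear system. -/
theorem UniformBounds.step (h : UniformBounds C K u w) (hg : AssumptionDynamics C g)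
    (hl : AssumptionCost C l) (hρ : IsLargeRate C K α d m ρ) {v : E d → E d}
    (hv : Differentiable ℝ v) {M : ℝ} (hM : ∀ x, ‖v x‖ ≤ M * (1 + ‖x‖ ^ m))
    (pde : ∀ x, ρ • v x = fderiv ℝ v x (g x (w x)) + source g l u w x) :
    (∀ x, ‖v x‖ ≤ stateBound K * (1 + ‖x‖)) ∧ ∀ x, ‖fderiv ℝ v x‖ ≤ stateBound K := by
  have hL := one_le_stateBound K
  have hS := sourceBound_nonneg C K
  have hS' := sourceLip_nonneg C K
  have hρ1 := hρ.growth
  have hρ2 := hρ.lipschitz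
  have h1 : ∀ x, ‖v x‖ ≤ stateBound K * (1 + ‖x‖) := fun x => by
    -- As `ρ` exceeds the rate by more than twice the source bound, this yields `‖v x‖ ≤ 1 + ‖x‖`;
    -- the summand 1 in `stateBound` leaves room for it. The gradient bound below works in the same
    -- way.
    have h2 := norm_le_of_transport hv hM pde (h.flow_growth hg) (h.source_growth hg hl)
      (by linarith) x
    have h3 : 2 * sourceBound C K * ‖v x‖ ≤ 2 * sourceBound C K * (1 + ‖x‖) :=
      le_trans (mul_le_mul_of_nonneg_right (by linarith) (norm_nonneg _)) h2
    set a := ρ - 2 * flowBound C K * (1 + m) with ha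
    have ha0 : 0 < a := by linarith
    refine le_of_mul_le_mul_left (h2.trans ?_) ha0
    calc 2 * sourceBound C K * (1 + ‖x‖) ≤ a * (1 + ‖x‖) := by gcongr; linarith
      _ ≤ a * (stateBound K * (1 + ‖x‖)) := by
        gcongr
        exact le_mul_of_one_le_left (by positivity) hL
  refine ⟨h1, norm_fderiv_le_of_norm_sub_le (by linarith) fun x y => ?_⟩
  have h2 := norm_sub_le_of_transport hv h1 pde (h.flow_growth hg) (flowLip_nonneg C K)
    (h.flow_lip hg) hS' (h.source_lip hg hl) (by linarith) x y
  set a := ρ - (flowLip C K + 4 * flowBound C K) with ha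
  have ha0 : 0 < a := by linarith
  refine le_of_mul_le_mul_left (h2.trans ?_) ha0
  calc sourceLip C K * ‖x - y‖ ≤ a * ‖x - y‖ := by gcongr; linarith
    _ ≤ a * (stateBound K * ‖x - y‖) := by
      gcongr
      exact le_mul_of_one_le_left (by positivity) hL

variable {lam : ℕ → E d → E d} {a : ℕ → E d → E p}

theorem IsPILambda.transport (hP : IsPILambda ρ g l m lam a) (k : ℕ) (x : E d) :
    ρ • lam (k + 1) x = fderiv ℝ (lam (k + 1)) x (g x (a k x)) + source g l (lam k) (a k) x := by
  rw [source, ← hP.pde k x]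
  abel

theorem IsPILambda.uniformBounds (hP : IsPILambda ρ g l m lam a) (hg : AssumptionDynamics C g)
    (hl : AssumptionCost C l) (hρ : IsLargeRate C K α d m ρ) (h0 : LinearBounds K (lam 0))
    (ha0 : LinearBounds K (a 0)) (k : ℕ) : UniformBounds C K (lam k) (a k) := by
  induction k with
  | zero =>
    have hK : K ≤ |K| := le_abs_self K
    have hl1 := C.l1_pos
    have hc0 := C.c0_pos
    have hl2 := C.l2_pos
    have hcs := C.cs_pos
    have hL := one_le_stateBound K
    refine ⟨h0.differentiable, fun x => (h0.growth x).trans ?_, fun x => (h0.deriv_le x).trans ?_,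
      fun x => (ha0.growth x).trans ?_, fun x y =>
      (norm_sub_le_of_norm_fderiv_le ha0.differentiable ha0.deriv_le x y).trans ?_⟩
    · gcongr
      unfold stateBound
      linarith
    · unfold stateBound
      linarith
    · gcongr
      refine hK.trans (le_add_of_nonneg_right (by positivity))
    · gcongr
      refine hK.trans (le_add_of_nonneg_right (by positivity))
  | succ k ih =>
    have hd := (hP.smooth k).differentiable one_ne_zero
    obtain ⟨M, hM⟩ := hP.growth k
    obtain ⟨h1, h2⟩ := ih.step hg hl hρ hd hM (hP.transport k)
    exact uniformBounds_of_greedy hg hl (hP.greedy k) hd h1 h2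

/-! ### Contraction and pointwise convergence -/

/-- One step contracts the weighted supremum norm. -/
theorem norm_sub_le_of_residual (hρ : IsLargeRate C K α d m ρ) {v v₁ : E d → E d} {b : E d → E d}
    {δ : E d → ℝ} {D M : ℝ}
    (hv : Differentiable ℝ fun x => v x - v₁ x) (hM : ∀ x, ‖v x - v₁ x‖ ≤ M * (1 + ‖x‖))
    (hb : ∀ x, ‖b x‖ ≤ flowBound C K * (1 + ‖x‖))
    (hR : ∀ x, ‖ρ • (v x - v₁ x) - fderiv ℝ (fun x => v x - v₁ x) x (b x)‖ ≤
      residualBound C K * δ x) (hδ : ∀ x, δ x ≤ D * (1 + ‖x‖)) (x : E d) :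
    ‖v x - v₁ x‖ ≤ D / 2 * (1 + ‖x‖) := by
  have hΘ := residualBound_pos C K
  have hc := hρ.contraction
  -- Degree 1 gives the rate `4 * flowBound`; the margin `4 * residualBound` in the discount rate
  -- turns the factor 2 of the estimate into 1/2.
  have h1 := norm_le_of_transport (m := 1) hv (by simpa using hM)
    (fun x => (add_sub_cancel _ _).symm) hb (Φ := residualBound C K * D) (fun x => (hR x).trans (by
      rw [mul_assoc]; exact mul_le_mul_of_nonneg_left (hδ x) hΘ.le))
    (by norm_num; linarith) x
  set r := ρ - 2 * flowBound C K * (1 + (1 : ℕ)) with hr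
  have hr0 : 4 * residualBound C K ≤ r := by rw [hr]; norm_num; linarith
  have h2 : 4 * residualBound C K * ‖v x - v₁ x‖ ≤ 2 * (residualBound C K * D) * (1 + ‖x‖) :=
    (mul_le_mul_of_nonneg_right hr0 (norm_nonneg _)).trans h1
  refine le_of_mul_le_mul_left (h2.trans_eq ?_) (by positivity : 0 < 4 * residualBound C K)
  ring

/-- Greedy policies depend on the adjoint variable in a Lipschitz way, so the increment of the
policy can be eliminated. This does not apply to the pair with index 0, whose policy is not assumed
greedy. -/
theorem residual_le_of_greedy (hg : AssumptionDynamics C g) (hl : AssumptionCost C l)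
    {u u' : E d → E d} {w w' : E d → E p} (h : IsGreedy g l u w) (h' : IsGreedy g l u' w')
    (x : E d) :
    C.gb * ‖u x - u' x‖ + (C.l2 + stateBound K * C.cb) * ‖w x - w' x‖ ≤
      residualBound C K * ‖u x - u' x‖ := by
  have h1 := norm_greedy_sub_greedy_le hg hl h h' x
  have hL := one_le_stateBound K
  have hl2 := C.l2_pos
  have hcb := hg.cb_nonneg
  rw [residualBound, abs_of_nonneg hcb, add_mul C.gb, mul_assoc _ (C.cb / C.cs)]
  gcongr

theorem IsPILambda.residual_le (hP : IsPILambda ρ g l m lam a) (hg : AssumptionDynamics C g)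
    (hl : AssumptionCost C l) (hB : ∀ k, UniformBounds C K (lam k) (a k)) (k : ℕ) (x : E d) :
    ‖ρ • (lam (k + 2) x - lam (k + 1) x) -
      fderiv ℝ (fun x => lam (k + 2) x - lam (k + 1) x) x (g x (a (k + 1) x))‖ ≤
      C.gb * ‖lam (k + 1) x - lam k x‖ +
        (C.l2 + stateBound K * C.cb) * ‖a (k + 1) x - a k x‖ :=
  norm_residual_le hg hl ((hB _).differentiable x) ((hB _).differentiable x) ((hB _).deriv_le x)
    (hP.transport (k + 1) x) (hP.transport k x)

/-- The contraction starts from `lam 2 - lam 1`, estimated crudely by the uniform bounds, since `a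
0` is not assumed greedy. -/
theorem IsPILambda.norm_increment_le (hP : IsPILambda ρ g l m lam a)
    (hg : AssumptionDynamics C g) (hl : AssumptionCost C l) (hρ : IsLargeRate C K α d m ρ)
    (hB : ∀ k, UniformBounds C K (lam k) (a k)) (k : ℕ) (x : E d) :
    ‖lam (k + 2) x - lam (k + 1) x‖ ≤ 2 * stateBound K / 2 ^ k * (1 + ‖x‖) := by
  have hM : ∀ i j x, ‖lam i x - lam j x‖ ≤ 2 * stateBound K * (1 + ‖x‖) := fun i j x =>
    (norm_sub_le _ _).trans (by linarith [(hB i).growth x, (hB j).growth x])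
  induction k generalizing x with
  | zero => simpa using hM 2 1 x
  | succ k ih =>
    refine (norm_sub_le_of_residual hρ (b := fun x => g x (a (k + 2) x))
      ((hB _).differentiable.sub (hB _).differentiable)
      (hM (k + 3) (k + 2)) ((hB _).flow_growth hg)
      (fun x => (hP.residual_le hg hl hB (k + 1) x).trans
        (residual_le_of_greedy hg hl (hP.greedy (k + 1)) (hP.greedy k) x)) ih x).trans_eq ?_
    rw [pow_succ]
    ring

/-- A solution of this fixed-point equation is compared with the iterates along its own drift. The
gradient in the residual is then that of an iterate, so linear growth of `u` is the only
quantitative bound required. -/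
theorem IsPILambda.tendsto_of_isSolution (hP : IsPILambda ρ g l m lam a)
    (hg : AssumptionDynamics C g) (hl : AssumptionCost C l) (hρ : IsLargeRate C K α d m ρ)
    (hB : ∀ k, UniformBounds C K (lam k) (a k)) {u : E d → E d} {w : E d → E p}
    (hu : Differentiable ℝ u) (hK : ∀ x, ‖u x‖ ≤ stateBound K * (1 + ‖x‖)) (h : IsGreedy g l u w)
    (pde : ∀ x, ρ • u x = fderiv ℝ u x (g x (w x)) + source g l u w x) (x : E d) :
    Tendsto (fun k => lam k x) atTop (𝓝 (u x)) := by
  have hM : ∀ k x, ‖u x - lam k x‖ ≤ 2 * stateBound K * (1 + ‖x‖) := fun k x =>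
    (norm_sub_le _ _).trans (by linarith [(hB k).growth x, hK x])
  have key : ∀ k x, ‖u x - lam (k + 1) x‖ ≤ 2 * stateBound K / 2 ^ k * (1 + ‖x‖) := by
    intro k
    induction k with
    | zero => simpa using hM 1
    | succ k ih =>
      intro x
      refine (norm_sub_le_of_residual hρ (b := fun x => g x (w x))
        (hu.sub (hB _).differentiable) (hM (k + 2))
        (norm_dynamics_le hg (norm_greedy_le_policyBound hg hl h hK))
        (fun x => (norm_residual_le hg hl (hu x) ((hB _).differentiable x) ((hB _).deriv_le x)
          (pde x) (hP.transport (k + 1) x)).trans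
          (residual_le_of_greedy hg hl h (hP.greedy k) x)) ih x).trans_eq ?_
      rw [pow_succ]
      ring
  rw [← tendsto_add_atTop_iff_nat 1, tendsto_iff_norm_sub_tendsto_zero]
  refine squeeze_zero (fun _ => norm_nonneg _)
    (fun k => (norm_sub_rev _ _).trans_le (key k x)) ?_
  have h1 : Tendsto (fun k : ℕ => 2 * stateBound K * (1 + ‖x‖) * (1 / 2 : ℝ) ^ k) atTop (𝓝 0) := by
    simpa using (tendsto_pow_atTop_nhds_zero_of_lt_one (by norm_num : (0 : ℝ) ≤ 1 / 2)
      (by norm_num)).const_mul (2 * stateBound K * (1 + ‖x‖))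
  refine h1.congr fun k => ?_
  rw [one_div, inv_pow]
  ring

/-- The iterates and their policies converge pointwise. -/
theorem IsPILambda.exists_limit (hP : IsPILambda ρ g l m lam a)
    (hg : AssumptionDynamics C g) (hl : AssumptionCost C l) (hρ : IsLargeRate C K α d m ρ)
    (hB : ∀ k, UniformBounds C K (lam k) (a k)) :
    ∃ (u : E d → E d) (w : E d → E p), (∀ x, Tendsto (fun k => lam k x) atTop (𝓝 (u x))) ∧
      (∀ x, Tendsto (fun k => a k x) atTop (𝓝 (w x))) ∧ IsGreedy g l u w := by
  have hlam : ∀ x, ∃ y, Tendsto (fun k => lam k x) atTop (𝓝 y) := fun x => by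
    obtain ⟨y, hy⟩ := cauchySeq_tendsto_of_complete (cauchySeq_of_le_geometric_two
      (f := fun k => lam (k + 1) x) (C := 2 * (2 * stateBound K * (1 + ‖x‖))) fun k => by
        rw [dist_comm, dist_eq_norm]
        exact (hP.norm_increment_le hg hl hρ hB k x).trans_eq (by ring))
    exact ⟨y, (tendsto_add_atTop_iff_nat 1).1 hy⟩
  have ha : ∀ x, ∃ y, Tendsto (fun k => a k x) atTop (𝓝 y) := fun x => by
    obtain ⟨y, hy⟩ := cauchySeq_tendsto_of_complete (cauchySeq_of_le_geometric_two
      (f := fun k => a (k + 1) x) (C := C.cb / C.cs * (2 * (2 * stateBound K * (1 + ‖x‖))))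
      fun k => by
        rw [dist_comm, dist_eq_norm]
        refine (norm_greedy_sub_greedy_le hg hl (hP.greedy (k + 1)) (hP.greedy k) x).trans ?_
        refine (mul_le_mul_of_nonneg_left (hP.norm_increment_le hg hl hρ hB k x)
          (div_nonneg hg.cb_nonneg C.cs_pos.le)).trans_eq (by ring))
    exact ⟨y, (tendsto_add_atTop_iff_nat 1).1 hy⟩
  choose u hu using hlam
  choose w hw using ha
  refine ⟨u, w, hu, hw, fun x b => ?_⟩
  have hgc := hg.contDiff.continuous
  have hlc := hl.smooth.continuous
  have hHam : Continuous fun z : E d × E p => Ham g l x z.1 z.2 := by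
    unfold Ham
    exact ((hgc.comp (continuous_const.prodMk continuous_snd)).inner continuous_fst).add
      (hlc.comp (continuous_const.prodMk continuous_snd))
  have h1 := (hHam.tendsto (u x, w x)).comp ((hu x).prodMk_nhds (hw x))
  have h2 := (hHam.tendsto (u x, b)).comp ((hu x).prodMk_nhds tendsto_const_nhds)
  -- Minimality is a closed condition; it holds for the iterates from index 1 on.
  refine le_of_tendsto_of_tendsto h1 h2 ?_
  filter_upwards [eventually_ge_atTop 1] with k hk
  obtain ⟨j, rfl⟩ := Nat.exists_eq_add_of_le' hk
  exact hP.greedy j x b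

/-- One step contracts the `L²_α` norm. -/
theorem IsPILambda.sqNorm_le (hP : IsPILambda ρ g l m lam a)
    (hg : AssumptionDynamics C g) (hl : AssumptionCost C l) (hρ : IsLargeRate C K α d m ρ)
    (hα : 0 ≤ α) (hB : ∀ k, UniformBounds C K (lam k) (a k)) (k : ℕ) :
    ENNReal.ofReal ((2 * residualBound C K) ^ 2) *
      sqNorm α (fun x => lam (k + 2) x - lam (k + 1) x) ≤
    sqNorm α (fun x => ρ • (lam (k + 2) x - lam (k + 1) x) -
      fderiv ℝ (fun x => lam (k + 2) x - lam (k + 1) x) x (g x (a (k + 1) x))) := by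
  have hΘ := residualBound_pos C K
  -- The integration by parts in the energy estimate needs a differentiable drift, hence a
  -- differentiable policy.
  have hda : Differentiable ℝ (a (k + 1)) := fun x =>
    (hP.greedy k).differentiableAt hg hl ((hB _).differentiable x)
  have hdb : Differentiable ℝ fun x => g x (a (k + 1) x) :=
    (hg.contDiff.differentiable two_ne_zero).comp (differentiable_id.prodMk hda)
  have he := hρ.energy
  unfold energyRate at he
  have h1 := sqNorm_le_of_transport hα ((hP.smooth (k + 1)).sub (hP.smooth k))
    (M := 2 * stateBound K) (Λ := 2 * stateBound K)
    (R := fun x => ρ • (lam (k + 2) x - lam (k + 1) x) -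
      fderiv ℝ (fun x => lam (k + 2) x - lam (k + 1) x) x (g x (a (k + 1) x)))
    (fun x => (norm_sub_le _ _).trans
      (by linarith [(hB (k + 1 + 1)).growth x, (hB (k + 1)).growth x]))
    (fun x => by
      rw [fderiv_fun_sub ((hB _).differentiable x) ((hB _).differentiable x)]
      exact (norm_sub_le _ _).trans
        (by linarith [(hB (k + 1 + 1)).deriv_le x, (hB (k + 1)).deriv_le x]))
    hdb ((hB (k + 1)).flow_growth hg)
    (norm_fderiv_le_of_norm_sub_le (flowLip_nonneg C K) ((hB (k + 1)).flow_lip hg))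
    (ρ := ρ) (fun x => (add_sub_cancel _ _).symm) (by linarith)
  refine le_trans ?_ h1
  gcongr
  linarith

end

/-! ### The weighted `L²` norm -/

section SqNorm

variable {α : ℝ}

theorem measurable_weight : Measurable (weight (d := d) α) := by
  unfold weight
  fun_prop

/-- The measure with density `(1 + ‖x‖²) ^ (-2α)`. -/
noncomputable def weightMeasure (d : ℕ) (α : ℝ) : Measure (E d) :=
  volume.withDensity fun x => ENNReal.ofReal (weight α x)

/-- Passage to `eLpNorm` makes Minkowski's inequality and the Fatou property for pointwise limits
available. -/
theorem sqNorm_eq_eLpNorm_sq {u : E d → E n} (hu : Measurable u) :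
    sqNorm α u = eLpNorm u 2 (weightMeasure d α) ^ 2 := by
  have h := eLpNorm_nnreal_pow_eq_lintegral (f := u) (μ := weightMeasure d α) (p := 2) (by norm_num)
  have h2 : (((2 : NNReal) : ℝ)) = ((2 : ℕ) : ℝ) := by norm_num
  rw [h2, ENNReal.rpow_natCast] at h
  refine Eq.trans ?_ h.symm
  simp only [ENNReal.rpow_natCast]
  rw [weightMeasure, lintegral_withDensity_eq_lintegral_mul _
    (measurable_weight.ennreal_ofReal) (hu.enorm.pow_const 2)]
  refine lintegral_congr fun x => ?_
  rw [Pi.mul_apply, ENNReal.ofReal_mul (sq_nonneg _), mul_comm, ENNReal.ofReal_pow (norm_nonneg _),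
    ofReal_norm]

theorem sqNorm_le_of_norm_le {n' : ℕ} {u : E d → E n} {v : E d → E n'} {c : ℝ}
    (h : ∀ x, ‖u x‖ ≤ c * ‖v x‖) : sqNorm α u ≤ ENNReal.ofReal (c ^ 2) * sqNorm α v := by
  rw [sqNorm, sqNorm, ← lintegral_const_mul' _ _ ENNReal.ofReal_ne_top]
  refine lintegral_mono fun x => ?_
  rw [← ENNReal.ofReal_mul (sq_nonneg _), ← mul_assoc, ← mul_pow]
  have hw := weight_pos α x
  have := h x
  refine ENNReal.ofReal_le_ofReal ?_
  gcongr

theorem sqNorm_lt_top_of_norm_le {n₁ n₂ : ℕ} {u : E d → E n} {v₁ : E d → E n₁} {v₂ : E d → E n₂}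
    {c₁ c₂ : ℝ} (h : ∀ x, ‖u x‖ ≤ c₁ * ‖v₁ x‖ + c₂ * ‖v₂ x‖) (hm : Measurable v₁)
    (h₁ : sqNorm α v₁ < ⊤) (h₂ : sqNorm α v₂ < ⊤) : sqNorm α u < ⊤ := by
  have hm' : Measurable fun x => ENNReal.ofReal (2 * c₁ ^ 2) *
      ENNReal.ofReal (‖v₁ x‖ ^ 2 * weight α x) :=
    (((hm.norm.pow_const 2).mul measurable_weight).ennreal_ofReal).const_mul _
  have key : sqNorm α u ≤ ENNReal.ofReal (2 * c₁ ^ 2) * sqNorm α v₁ +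
      ENNReal.ofReal (2 * c₂ ^ 2) * sqNorm α v₂ := by
    rw [sqNorm, sqNorm, sqNorm, ← lintegral_const_mul' _ _ ENNReal.ofReal_ne_top,
      ← lintegral_const_mul' _ _ ENNReal.ofReal_ne_top, ← lintegral_add_left hm']
    refine lintegral_mono fun x => ?_
    have hw := weight_pos α x
    rw [← ENNReal.ofReal_mul (by positivity), ← ENNReal.ofReal_mul (by positivity),
      ← ENNReal.ofReal_add (by positivity) (by positivity)]
    refine ENNReal.ofReal_le_ofReal ?_
    have h3 : ‖u x‖ ^ 2 ≤ (c₁ * ‖v₁ x‖ + c₂ * ‖v₂ x‖) ^ 2 := by have := h x; gcongr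
    have h4 : ‖u x‖ ^ 2 ≤ 2 * c₁ ^ 2 * ‖v₁ x‖ ^ 2 + 2 * c₂ ^ 2 * ‖v₂ x‖ ^ 2 := by
      nlinarith [sq_nonneg (c₁ * ‖v₁ x‖ - c₂ * ‖v₂ x‖)]
    calc _ ≤ (2 * c₁ ^ 2 * ‖v₁ x‖ ^ 2 + 2 * c₂ ^ 2 * ‖v₂ x‖ ^ 2) * weight α x := by gcongr
      _ = _ := by ring
  exact key.trans_lt (ENNReal.add_lt_top.2 ⟨ENNReal.mul_lt_top ENNReal.ofReal_lt_top h₁,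
    ENNReal.mul_lt_top ENNReal.ofReal_lt_top h₂⟩)

/-- The integrand is at most a multiple of `(1 + ‖x‖²) ^ (1 - 2α)`, which is integrable exactly when
`4α - 2 > d`. -/
theorem sqNorm_lt_top_of_linear_growth (hα : (d : ℝ) + 2 < 4 * α) {u : E d → E n} {M : ℝ}
    (hM : ∀ x, ‖u x‖ ≤ M * (1 + ‖x‖)) : sqNorm α u < ⊤ := by
  have hi := (integrable_rpow_neg_one_add_norm_sq (E := E d) (μ := volume)
    (r := 4 * α - 2) (by simp; linarith)).const_mul (2 * M ^ 2)
  refine lt_of_le_of_lt (lintegral_mono fun x => ?_) hi.lintegral_lt_top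
  refine ENNReal.ofReal_le_ofReal ?_
  have hs : (0 : ℝ) < 1 + ‖x‖ ^ 2 := by positivity
  have h1 : ‖u x‖ ^ 2 ≤ 2 * M ^ 2 * (1 + ‖x‖ ^ 2) := by
    have h2 : ‖u x‖ ^ 2 ≤ (M * (1 + ‖x‖)) ^ 2 := by have := hM x; gcongr
    nlinarith [mul_nonneg (sq_nonneg M) (sq_nonneg (‖x‖ - 1))]
  have h2 : (1 + ‖x‖ ^ 2 : ℝ) ^ (-(4 * α - 2) / 2) = (1 + ‖x‖ ^ 2) * weight α x := by
    rw [weight, ← Real.rpow_neg hs.le]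
    nth_rw 2 [← Real.rpow_one (1 + ‖x‖ ^ 2)]
    rw [← Real.rpow_add hs]
    congr 1
    ring
  rw [h2, ← mul_assoc]
  exact mul_le_mul_of_nonneg_right h1 (weight_pos α x).le

/-- A pointwise convergent sequence whose increments eventually contract in `L²_α` converges
in `L²_α`. -/
theorem tendsto_sqNorm_of_contraction {u : ℕ → E d → E n} {v : E d → E n}
    (hc : ∀ k, Continuous (u k)) (hlim : ∀ x, Tendsto (fun k => u k x) atTop (𝓝 (v x)))
    (hv : Measurable v) (h1 : sqNorm α (fun x => u 1 x - u 0 x) < ⊤)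
    (h2 : sqNorm α (fun x => u 2 x - u 1 x) < ⊤)
    (hcontr : ∀ k, 4 * sqNorm α (fun x => u (k + 3) x - u (k + 2) x) ≤
      sqNorm α (fun x => u (k + 2) x - u (k + 1) x)) :
    Tendsto (fun k => sqNorm α fun x => u k x - v x) atTop (𝓝 0) ∧
      (sqNorm α (u 0) < ⊤ → sqNorm α v < ⊤) := by
  set μ := weightMeasure d α
  have hm : ∀ k, AEStronglyMeasurable (u k) μ := fun k => (hc k).aestronglyMeasurable
  have hvm : AEStronglyMeasurable v μ := hv.aestronglyMeasurable
  have heq : ∀ i j, sqNorm α (fun x => u i x - u j x) = eLpNorm (u i - u j) 2 μ ^ 2 := fun i j =>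
    sqNorm_eq_eLpNorm_sq ((hc i).sub (hc j)).measurable
  have heqv : ∀ i, sqNorm α (fun x => u i x - v x) = eLpNorm (u i - v) 2 μ ^ 2 := fun i =>
    sqNorm_eq_eLpNorm_sq ((hc i).measurable.sub hv)
  have htop : ∀ {s : ℝ≥0∞}, s ^ 2 < ⊤ ↔ s < ⊤ := fun {s} => by simp
  set D := eLpNorm (u 2 - u 1) 2 μ with hD
  have hDtop : D < ⊤ := htop.1 (heq 2 1 ▸ h2)
  have hstep : ∀ k, eLpNorm (u (k + 2) - u (k + 1)) 2 μ ≤ D * 2⁻¹ ^ k := by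
    intro k
    induction k with
    | zero => simp [hD]
    | succ k ih =>
      have h3 := hcontr k
      rw [heq, heq, show (4 : ℝ≥0∞) = 2 ^ 2 by norm_num, ← mul_pow] at h3
      have h4 := (ENNReal.pow_le_pow_left_iff two_ne_zero).1 h3
      rw [pow_succ, ← mul_assoc]
      have h5 := h4.trans ih
      rw [mul_comm] at h5
      rw [← div_eq_mul_inv]
      exact (ENNReal.le_div_iff_mul_le (by simp) (by simp)).2 h5
  -- The unused tail of the geometric series is kept on the left, so that the induction closes
  -- without subtraction in `ℝ≥0∞`.
  have hsum : ∀ N j, eLpNorm (u (N + j + 1) - u (N + 1)) 2 μ + D * 2 * 2⁻¹ ^ (N + j) ≤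
      D * 2 * 2⁻¹ ^ N := by
    intro N j
    induction j with
    | zero => simp
    | succ j ih =>
      refine le_trans ?_ ih
      have e1 : u (N + (j + 1) + 1) - u (N + 1) =
        (u (N + j + 1) - u (N + 1)) + (u (N + j + 2) - u (N + j + 1)) := by
        rw [show N + (j + 1) + 1 = N + j + 2 by ring]
        abel
      have e2 : D * 2 * 2⁻¹ ^ (N + j) = D * 2⁻¹ ^ (N + j) + D * 2 * 2⁻¹ ^ (N + (j + 1)) := by
        rw [← add_assoc N j 1, pow_succ]
        have : D * 2 * (2⁻¹ ^ (N + j) * 2⁻¹) = D * 2⁻¹ ^ (N + j) * (2 * 2⁻¹) := by ring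
        rw [this, ENNReal.mul_inv_cancel (by simp) (by simp)]
        ring
      rw [e1, e2]
      refine (add_le_add ?_ le_rfl).trans_eq (add_assoc _ _ _)
      refine (eLpNorm_add_le ((hm _).sub (hm _)) ((hm _).sub (hm _)) (by norm_num)).trans ?_
      exact add_le_add le_rfl (hstep (N + j))
  -- The Fatou property transfers the uniform bound on `u (N + j + 1) - u (N + 1)` to the pointwise
  -- limit `j → ∞`.
  have hbound : ∀ N, eLpNorm (u (N + 1) - v) 2 μ ≤ D * 2 * 2⁻¹ ^ N := by
    intro N
    rw [eLpNorm_sub_comm]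
    refine (Lp.eLpNorm_lim_le_liminf_eLpNorm (f := fun j => u (N + j + 1) - u (N + 1))
      (fun j => (hm _).sub (hm _)) _ (Eventually.of_forall fun x => ?_)).trans
      (liminf_le_of_frequently_le' (f := (atTop : Filter ℕ)) (Eventually.of_forall fun j =>
        le_self_add.trans (hsum N j)).frequently)
    have := (tendsto_add_atTop_iff_nat (N + 1)).2 (hlim x)
    refine Tendsto.sub_const (this.congr fun j => ?_) _
    rw [show j + (N + 1) = N + j + 1 by ring]
  constructor
  · have h0 : Tendsto (fun N : ℕ => D * 2 * 2⁻¹ ^ N) atTop (𝓝 0) := by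
      have := ENNReal.Tendsto.const_mul (ENNReal.tendsto_pow_atTop_nhds_zero_of_lt_one
        (ENNReal.inv_lt_one.2 (by norm_num : (1 : ℝ≥0∞) < 2)))
        (Or.inr (ENNReal.mul_ne_top hDtop.ne (by simp) : D * 2 ≠ ⊤))
      rwa [mul_zero] at this
    have h3 : Tendsto (fun N => eLpNorm (u (N + 1) - v) 2 μ) atTop (𝓝 0) :=
      tendsto_of_tendsto_of_tendsto_of_le_of_le tendsto_const_nhds h0 (fun _ => zero_le) hbound
    simp only [heqv]
    rw [← tendsto_add_atTop_iff_nat 1]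
    have h4 := ((ENNReal.continuous_pow 2).tendsto 0).comp h3
    rw [zero_pow two_ne_zero] at h4
    exact h4
  · intro h0
    rw [sqNorm_eq_eLpNorm_sq (hc 0).measurable, htop] at h0
    rw [heq, htop] at h1
    rw [sqNorm_eq_eLpNorm_sq hv, htop]
    have e1 : v = u 0 + ((u 1 - u 0) - (u 1 - v)) := by abel
    rw [e1]
    refine (eLpNorm_add_le (hm 0) (((hm _).sub (hm _)).sub ((hm _).sub hvm))
      (by norm_num)).trans_lt (ENNReal.add_lt_top.2 ⟨h0, ?_⟩)
    refine (eLpNorm_sub_le ((hm _).sub (hm _)) ((hm _).sub hvm)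
      (by norm_num)).trans_lt (ENNReal.add_lt_top.2 ⟨h1, ?_⟩)
    refine (hbound 0).trans_lt ?_
    simpa using ENNReal.mul_lt_top hDtop (by simp)

end SqNorm

/-! ### Passage to the limit in the equation -/

section Weak

variable {ρ α : ℝ} {g : E d → E p → E d} {l : E d → E p → ℝ} {C : Constants}

/-- The almost everywhere differential of a Lipschitz map is its weak Jacobi matrix. -/
theorem isWeakJacobian_of_lipschitz {u : E d → E d} {L : ℝ} (hL : 0 ≤ L)
    (h : ∀ x y, ‖u x - u y‖ ≤ L * ‖x - y‖) : IsWeakJacobian u (fderiv ℝ u) := by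
  have hlip : LipschitzWith ⟨L, hL⟩ u := LipschitzWith.of_dist_le_mul fun x y => by
    rw [dist_eq_norm, dist_eq_norm]; exact h x y
  have hJ : LocallyIntegrable (fderiv ℝ u) :=
    (locallyIntegrable_const L).mono (measurable_fderiv ℝ u).aestronglyMeasurable
      (Eventually.of_forall fun x =>
        (norm_fderiv_le_of_norm_sub_le hL h x).trans (le_abs_self L))
  refine ⟨hlip.continuous.locallyIntegrable, hJ, fun φ hφ hφc v => ?_⟩
  obtain ⟨D, hD⟩ := hφ.lipschitzWith_of_hasCompactSupport hφc (by simp)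
  have hφ1 : Differentiable ℝ φ := hφ.differentiable (by simp)
  have hJv : LocallyIntegrable fun x => fderiv ℝ u x v :=
    (locallyIntegrable_const (L * ‖v‖)).mono
      (measurable_fderiv_apply_const ℝ u v).aestronglyMeasurable
      (Eventually.of_forall fun x =>
        (ContinuousLinearMap.le_of_opNorm_le _ (norm_fderiv_le_of_norm_sub_le hL h x) v).trans
        (le_abs_self _))
  have i1 : Integrable fun x => fderiv ℝ φ x v • u x := by
    refine Continuous.integrable_of_hasCompactSupport ?_ ?_
    · exact ((hφ.continuous_fderiv (by simp)).clm_apply continuous_const).smul hlip.continuous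
    · exact (hφc.fderiv_apply ℝ v).smul_right
  have i2 : Integrable fun x => φ x • fderiv ℝ u x v :=
    hJv.integrable_smul_left_of_hasCompactSupport hφ.continuous hφc
  ext j
  have e1 := (EuclideanSpace.proj j : E d →L[ℝ] ℝ).integral_comp_comm i1
  have e2 := (EuclideanSpace.proj j : E d →L[ℝ] ℝ).integral_comp_comm i2
  refine e1.symm.trans (Eq.trans ?_ (congrArg Neg.neg e2))
  change ∫ x, (fderiv ℝ φ x v • u x) j = -∫ x, (φ x • fderiv ℝ u x v) j
  have hj : LipschitzWith ⟨L, hL⟩ fun x => u x j := LipschitzWith.of_dist_le_mul fun x y => by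
    refine le_trans ?_ (hlip.dist_le_mul x y)
    rw [dist_eq_norm, dist_eq_norm]
    exact PiLp.norm_apply_le (u x - u y) j
  -- Integration by parts for two Lipschitz functions, one with compact support, in each component.
  -- By Rademacher's theorem the line derivatives agree almost everywhere with the Fréchet
  -- derivative.
  have key := hj.integral_lineDeriv_mul_eq (μ := volume) hD hφc v
  have h1 : ∀ᵐ x : E d, lineDeriv ℝ (fun x => u x j) x v * φ x = (φ x • fderiv ℝ u x v) j := by
    filter_upwards [hlip.ae_differentiableAt] with x hx
    have : HasFDerivAt (fun x => u x j)
      ((EuclideanSpace.proj j : E d →L[ℝ] ℝ).comp (fderiv ℝ u x)) x :=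
      (EuclideanSpace.proj j : E d →L[ℝ] ℝ).hasFDerivAt.comp x hx.hasFDerivAt
    rw [this.differentiableAt.lineDeriv_eq_fderiv, this.fderiv]
    simp [mul_comm]
  have h2 : ∀ x : E d, lineDeriv ℝ φ x (-v) * u x j = -(fderiv ℝ φ x v • u x) j := fun x => by
    rw [(hφ1 x).lineDeriv_eq_fderiv]
    simp
  rw [integral_congr_ae h1] at key
  simp only [h2] at key
  rw [key, integral_neg, neg_neg]

/-- A pointwise limit of solutions of transport equations with uniformly Lipschitz data solves
the limit equation wherever it is differentiable. -/
theorem transport_of_tendsto {u F : ℕ → E d → E n} {b : ℕ → E d → E d} {u₀ F₀ : E d → E n}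
    {b₀ : E d → E d} {L B Φ : ℝ} {x : E d} (hu : ∀ k, Differentiable ℝ (u k))
    (hL : ∀ k x, ‖fderiv ℝ (u k) x‖ ≤ L) (hB : ∀ k x y, ‖b k x - b k y‖ ≤ B * ‖x - y‖)
    (hΦ : ∀ k x y, ‖F k x - F k y‖ ≤ Φ * ‖x - y‖)
    (pde : ∀ k x, ρ • u k x = fderiv ℝ (u k) x (b k x) + F k x)
    (hu₀ : ∀ x, Tendsto (fun k => u k x) atTop (𝓝 (u₀ x)))
    (hb₀ : Tendsto (fun k => b k x) atTop (𝓝 (b₀ x)))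
    (hF₀ : Tendsto (fun k => F k x) atTop (𝓝 (F₀ x)))
    (hx : DifferentiableAt ℝ u₀ x) : ρ • u₀ x = fderiv ℝ u₀ x (b₀ x) + F₀ x := by
  set v := b₀ x with hv
  set q := ρ • u₀ x - F₀ x with hq
  have hL0 : 0 ≤ L := (norm_nonneg _).trans (hL 0 0)
  set M := L * (B * ‖v‖) + |ρ| * (L * ‖v‖) + Φ * ‖v‖ with hM
  let e : ℕ → ℝ := fun k => L * ‖v - b k x‖ + ‖ρ • u k x - F k x - q‖
  have he : Tendsto e atTop (𝓝 0) := by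
    have h1 : Tendsto (fun k => L * ‖v - b k x‖) atTop (𝓝 (L * ‖v - v‖)) :=
      ((tendsto_const_nhds.sub hb₀).norm).const_mul L
    have h2 : Tendsto (fun k => ‖ρ • u k x - F k x - q‖) atTop (𝓝 ‖q - q‖) :=
      (((((hu₀ x).const_smul ρ).sub hF₀)).sub_const q).norm
    simpa using h1.add h2
  have hline : ∀ s : ℝ, HasDerivAt (fun s : ℝ => x + s • v) v s := fun s => by
    simpa using ((hasDerivAt_id s).smul_const v).const_add x
  -- The equation at `x + s v` shows that `Du_k v` is close to `q` on the whole ray: the drift there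
  -- differs from `v` by `O(s)` plus an error tending to 0, and all other terms are uniformly
  -- Lipschitz.
  have hM' : ∀ k (s : ℝ), 0 ≤ s → ‖fderiv ℝ (u k) (x + s • v) v - q‖ ≤ e k + M * s := by
    intro k s hs
    have hxs : ‖x + s • v - x‖ = s * ‖v‖ := by
      rw [add_sub_cancel_left, norm_smul, Real.norm_of_nonneg hs]
    have hdec : fderiv ℝ (u k) (x + s • v) v - q =
        fderiv ℝ (u k) (x + s • v) (v - b k x) - fderiv ℝ (u k) (x + s • v)
          (b k (x + s • v) - b k x) + ρ • (u k (x + s • v) - u k x) -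
          (F k (x + s • v) - F k x) + (ρ • u k x - F k x - q) := by
      have h1 := pde k (x + s • v)
      rw [smul_sub, h1]
      simp only [map_sub]
      abel
    rw [hdec]
    have h1 : ‖fderiv ℝ (u k) (x + s • v) (v - b k x)‖ ≤ L * ‖v - b k x‖ :=
      ContinuousLinearMap.le_of_opNorm_le _ (hL k _) _
    have h2 : ‖fderiv ℝ (u k) (x + s • v) (b k (x + s • v) - b k x)‖ ≤ L * (B * (s * ‖v‖)) :=
      ContinuousLinearMap.le_of_opNorm_le_of_le _ (hL k _) (hxs ▸ hB k _ _)
    have h3 : ‖ρ • (u k (x + s • v) - u k x)‖ ≤ |ρ| * (L * (s * ‖v‖)) := by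
      rw [norm_smul, Real.norm_eq_abs, ← hxs]
      gcongr
      exact norm_sub_le_of_norm_fderiv_le (hu k) (hL k) _ _
    have h4 : ‖F k (x + s • v) - F k x‖ ≤ Φ * (s * ‖v‖) := hxs ▸ hΦ k _ _
    refine (norm_add_le_of_le (norm_sub_le_of_le (norm_add_le_of_le (norm_sub_le_of_le h1 h2) h3)
      h4) le_rfl).trans_eq ?_
    simp only [e, hM]
    ring
  -- Integration along the ray and the limit in `k` leave a quadratic error, so `u₀` has one-sided
  -- derivative `q` along `v` at `x`. Differentiability identifies it with `Du₀ v`.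
  have hest : ∀ t : ℝ, 0 < t → ‖u₀ (x + t • v) - u₀ x - t • q‖ ≤ M * t * t := by
    intro t ht
    have h1 : ∀ k, ‖u k (x + t • v) - u k x - t • q‖ ≤ (e k + M * t) * t := by
      intro k
      have hd : ∀ s ∈ Set.Icc (0 : ℝ) t, HasDerivWithinAt (fun s : ℝ => u k (x + s • v) - s • q)
          (fderiv ℝ (u k) (x + s • v) v - q) (Set.Icc 0 t) s := fun s _ => by
        have h2 := ((hu k _).hasFDerivAt.comp_hasDerivAt s (hline s)).sub
          ((hasDerivAt_id s).smul_const q)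
        simp only [one_smul] at h2
        exact h2.hasDerivWithinAt
      have hM0 : 0 ≤ M := by
        have hBv : 0 ≤ B * ‖v‖ := by
          simpa using (norm_nonneg _).trans (hB 0 (x + v) x)
        have hΦv : 0 ≤ Φ * ‖v‖ := by
          simpa using (norm_nonneg _).trans (hΦ 0 (x + v) x)
        positivity
      have h3 := (convex_Icc 0 t).norm_image_sub_le_of_norm_hasDerivWithin_le hd
        (C := e k + M * t) (fun s hs => (hM' k s hs.1).trans (by
          have := mul_le_mul_of_nonneg_left hs.2 hM0
          linarith)) (Set.left_mem_Icc.2 ht.le) (Set.right_mem_Icc.2 ht.le)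
      simp only [zero_smul, add_zero, sub_zero, Real.norm_of_nonneg ht.le] at h3
      rwa [sub_right_comm] at h3
    have h2 := (((hu₀ (x + t • v)).sub (hu₀ x)).sub_const (t • q)).norm
    have h3 : Tendsto (fun k => (e k + M * t) * t) atTop (𝓝 (M * t * t)) := by
      simpa using (he.add_const (M * t)).mul_const t
    exact le_of_tendsto_of_tendsto' h2 h3 h1
  have hslope : Tendsto (fun t : ℝ => t⁻¹ • (u₀ (x + t • v) - u₀ x)) (𝓝[>] 0)
      (𝓝 (fderiv ℝ u₀ x v)) := by
    have hx' : HasFDerivAt u₀ (fderiv ℝ u₀ x) (x + (0 : ℝ) • v) := by simpa using hx.hasFDerivAt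
    have := (hx'.comp_hasDerivAt (0 : ℝ) (hline 0)).tendsto_slope_zero_right
    simpa using this
  have hslope' : Tendsto (fun t : ℝ => t⁻¹ • (u₀ (x + t • v) - u₀ x)) (𝓝[>] 0) (𝓝 q) := by
    rw [tendsto_iff_norm_sub_tendsto_zero]
    have h0 : Tendsto (fun t : ℝ => M * t) (𝓝[>] 0) (𝓝 0) := by
      have := ((continuous_const_mul M).tendsto (0 : ℝ)).mono_left
        (nhdsWithin_le_nhds (s := Set.Ioi 0))
      simpa using this
    refine tendsto_of_tendsto_of_tendsto_of_le_of_le' tendsto_const_nhds h0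
      (Eventually.of_forall fun _ => norm_nonneg _) ?_
    filter_upwards [self_mem_nhdsWithin] with t (ht : 0 < t)
    have h1 : t⁻¹ • (u₀ (x + t • v) - u₀ x) - q = t⁻¹ • (u₀ (x + t • v) - u₀ x - t • q) := by
      rw [smul_sub t⁻¹ _ (t • q), inv_smul_smul₀ ht.ne']
    rw [h1, norm_smul, norm_inv, Real.norm_of_nonneg ht.le, ← div_eq_inv_mul, div_le_iff₀ ht]
    exact hest t ht
  have := tendsto_nhds_unique hslope hslope'
  rw [this, hq, sub_add_cancel]

theorem weakIdentity_of_ae {u : E d → E d} {w : E d → E p} {J : E d → E d →L[ℝ] E d}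
    (hg : AssumptionDynamics C g) (hl : AssumptionCost C l) (hu : Continuous u) (hw : Continuous w)
    (h : ∀ᵐ x, ρ • u x = J x (g x (w x)) + source g l u w x) : WeakIdentity ρ α g l u w J := by
  intro φ hφ hφc
  have hψ : Continuous fun x => φ x * weight α x := by
    refine hφ.continuous.mul ?_
    unfold weight
    have h0 : ∀ x : E d, 0 < 1 + ‖x‖ ^ 2 := fun x => by positivity
    exact ((continuous_const.add (continuous_norm.pow 2)).rpow_const
      fun x => Or.inl (h0 x).ne').inv₀ fun x => (Real.rpow_pos_of_pos (h0 x) _).ne'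
  have hψc : HasCompactSupport fun x => φ x * weight α x := hφc.mul_right
  have hint : ∀ f : E d → E d, Continuous f →
      Integrable fun x => (φ x * weight α x) • f x := fun f hf =>
    (hψ.smul hf).integrable_of_hasCompactSupport hψc.smul_right
  obtain ⟨adj, hadj⟩ := exists_adjointCLM d
  have c3 : Continuous fun x => ContinuousLinearMap.adjoint (Dx g x (w x)) (u x) := by
    simp only [← hadj, hg.Dx_eq _ (w _)]
    exact (adj.continuous.comp hg.contDiff_Dx.continuous).clm_apply hu
  have c4 : Continuous fun x => gradX l x (w x) :=
    (contDiff_gradX hl.smooth).continuous.comp (continuous_id.prodMk hw)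
  have i1 := hint _ (hu.const_smul ρ)
  have i3 := hint _ c3
  have i4 := hint _ c4
  -- The term with `J` inherits measurability and integrability from the other three through the
  -- equation; nothing is assumed about `J` itself.
  have h2 : (fun x => (φ x * weight α x) • (ρ • u x) -
      ((φ x * weight α x) • ContinuousLinearMap.adjoint (Dx g x (w x)) (u x) +
        (φ x * weight α x) • gradX l x (w x))) =ᵐ[volume]
      fun x => (φ x * weight α x) • J x (g x (w x)) := by
    filter_upwards [h] with x hx
    rw [hx, ← smul_add, ← smul_sub, source, add_sub_cancel_right]
  have i2 := (i1.sub (i3.add i4)).congr h2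
  refine ⟨i1, i2, i3, i4, ?_⟩
  have e1 := integral_sub i1 (i3.add i4)
  have e2 := integral_add i3 i4
  simp only [Pi.add_apply, Pi.smul_apply] at e1 e2
  rw [← integral_congr_ae h2, e1, e2, add_assoc, sub_add_cancel]

end Weak

/-! ### Symmetry of the Jacobi matrix of a classical solution -/

section Classical

variable {ρ : ℝ} {g : E d → E p → E d} {l : E d → E p → ℝ} {C : Constants}

/-- The Jacobi matrix of a classical solution is symmetric: by the envelope theorem,
`ρ λ` is the gradient of the minimized Hamiltonian. -/
theorem IsClassicalSolution.adjoint_fderiv (hg : AssumptionDynamics C g) (hl : AssumptionCost C l)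
    {u : E d → E d} {w : E d → E p} (h : IsClassicalSolution ρ g l u w) (hρ : ρ ≠ 0) (x : E d) :
    ContinuousLinearMap.adjoint (fderiv ℝ u x) = fderiv ℝ u x := by
  obtain ⟨c, -, hc⟩ := hg.exists_affine
  have hud := h.smooth.differentiable one_ne_zero
  have hV : ∀ x, HasFDerivAt (fun x => Ham g l x (u x) (w x)) (innerSL ℝ (ρ • u x)) x := by
    intro x
    have hw := (h.greedy.differentiableAt hg hl (hud x)).hasFDerivAt
    have hgx : HasFDerivAt (fun x => g x (w x))
        (Dx g x (w x) + (ContinuousLinearMap.adjoint c).comp (fderiv ℝ w x)) x := by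
      have e : (fun x => g x (w x)) = fun x => g x 0 + ContinuousLinearMap.adjoint c (w x) :=
        funext fun x => hc x _
      rw [e, hg.Dx_eq]
      exact ((hg.contDiff_zero.differentiable two_ne_zero x).hasFDerivAt).add
        ((ContinuousLinearMap.adjoint c).hasFDerivAt.comp x hw)
    have hlx := (hasFDerivAt_cost hl.smooth x (w x)).comp x ((hasFDerivAt_id x).prodMk hw)
    have hH := (hgx.inner ℝ (hud x).hasFDerivAt).add hlx
    refine hH.congr_fderiv ?_
    ext v
    -- The first-order condition cancels the two terms containing `Dw`; what remains is the
    -- right-hand side of the value-gradient system.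
    have hfoc := gradA_eq_of_isMin hl hc (h.greedy x)
    rw [h.pde x]
    simp [hfoc, inner_add_left, ContinuousLinearMap.adjoint_inner_left]
    rw [real_inner_comm (u x), real_inner_comm (fderiv ℝ w x v)]
    ring
  have hsym := fun v w => second_derivative_symmetric
    (f' := fun x => innerSL ℝ (ρ • u x)) (f'' := (innerSL ℝ).comp (ρ • fderiv ℝ u x)) hV
    (x := x) (((innerSL ℝ).hasFDerivAt).comp x ((hud x).hasFDerivAt.const_smul ρ)) v w
  refine (ContinuousLinearMap.eq_adjoint_iff _ _).2 (fun v w => ?_) |>.symm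
  have := hsym v w
  simp [hρ] at this
  rw [this, real_inner_comm]

end Classical

/-! ### Convergence in `L²_α` and the limit equation -/

variable {C : Constants} {K α ρ : ℝ} {m : ℕ} {g : E d → E p → E d} {l : E d → E p → ℝ}
  {lam : ℕ → E d → E d} {a : ℕ → E d → E p}

/-- Any pointwise limit of the iterates is their limit in `L²_α`. -/
theorem IsPILambda.tendsto_sqNorm (hP : IsPILambda ρ g l m lam a) (hg : AssumptionDynamics C g)
    (hl : AssumptionCost C l) (hρ : IsLargeRate C K α d m ρ) (hα : 0 ≤ α)
    (hB : ∀ k, UniformBounds C K (lam k) (a k))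
    (h1 : sqNorm α (fun x => lam 1 x - lam 0 x) < ⊤) (h2 : sqNorm α (fun x => a 1 x - a 0 x) < ⊤)
    {u : E d → E d} (hu : Measurable u) (hlim : ∀ x, Tendsto (fun k => lam k x) atTop (𝓝 (u x))) :
    Tendsto (fun k => sqNorm α fun x => lam k x - u x) atTop (𝓝 0) ∧
      (sqNorm α (lam 0) < ⊤ → sqNorm α u < ⊤) := by
  have hΘ := residualBound_pos C K
  have hc : ∀ k, Continuous (lam k) := fun k => (hB k).differentiable.continuous
  refine tendsto_sqNorm_of_contraction hc hlim hu h1 ?_ fun k => ?_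
  -- In the first step the increment `a 1 - a 0` cannot be estimated by `lam 1 - lam 0`, so its
  -- finite norm enters as a separate hypothesis.
  · have h3 := hP.sqNorm_le hg hl hρ hα hB 0
    have h4 := sqNorm_lt_top_of_norm_le (hP.residual_le hg hl hB 0) ((hc 1).sub (hc 0)).measurable
      h1 h2
    have h5 := h3.trans_lt h4
    by_contra h6
    rw [not_lt, top_le_iff] at h6
    rw [zero_add, zero_add, h6, ENNReal.mul_top (by simpa using hΘ.ne')] at h5
    exact lt_irrefl _ h5
  · have h3 := hP.sqNorm_le hg hl hρ hα hB (k + 1)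
    have h4 := sqNorm_le_of_norm_le (α := α) (fun x => (hP.residual_le hg hl hB (k + 1) x).trans
      (residual_le_of_greedy hg hl (hP.greedy (k + 1)) (hP.greedy k) x))
    have h5 := h3.trans h4
    have e : ENNReal.ofReal ((2 * residualBound C K) ^ 2) =
        ENNReal.ofReal (residualBound C K ^ 2) * 4 := by
      rw [mul_pow, mul_comm, ENNReal.ofReal_mul (sq_nonneg _)]
      norm_num
    rw [e, mul_assoc] at h5
    exact (ENNReal.mul_le_mul_iff_right (by simpa using hΘ.ne') ENNReal.ofReal_ne_top).1 h5

/-- The pointwise limit of the iterates is a Lipschitz weak solution. -/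
theorem IsPILambda.weak_solution (hP : IsPILambda ρ g l m lam a) (hg : AssumptionDynamics C g)
    (hl : AssumptionCost C l) (hB : ∀ k, UniformBounds C K (lam k) (a k))
    {u : E d → E d} {w : E d → E p} (hu : ∀ x, Tendsto (fun k => lam k x) atTop (𝓝 (u x)))
    (hw : ∀ x, Tendsto (fun k => a k x) atTop (𝓝 (w x))) :
    Continuous u ∧ IsWeakJacobian u (fderiv ℝ u) ∧ WeakIdentity ρ α g l u w (fderiv ℝ u) := by
  have hL : 0 ≤ stateBound K := zero_le_one.trans (one_le_stateBound K)
  have hulip : ∀ x y, ‖u x - u y‖ ≤ stateBound K * ‖x - y‖ := fun x y =>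
    le_of_tendsto ((hu x).sub (hu y)).norm (Eventually.of_forall fun k =>
      norm_sub_le_of_norm_fderiv_le (hB k).differentiable (hB k).deriv_le x y)
  have hwlip : ∀ x y, ‖w x - w y‖ ≤ policyLip C K * ‖x - y‖ := fun x y =>
    le_of_tendsto ((hw x).sub (hw y)).norm (Eventually.of_forall fun k => (hB k).policy_lip x y)
  have hul : LipschitzWith ⟨stateBound K, hL⟩ u := LipschitzWith.of_dist_le_mul fun x y => by
    rw [dist_eq_norm, dist_eq_norm]; exact hulip x y
  have hwl : LipschitzWith ⟨policyLip C K, policyLip_nonneg C K⟩ w :=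
    LipschitzWith.of_dist_le_mul fun x y => by
      rw [dist_eq_norm, dist_eq_norm]; exact hwlip x y
  refine ⟨hul.continuous, isWeakJacobian_of_lipschitz hL hulip,
    weakIdentity_of_ae hg hl hul.continuous hwl.continuous ?_⟩
  filter_upwards [hul.ae_differentiableAt] with x hx
  refine transport_of_tendsto (u := fun k => lam (k + 1)) (F := fun k => source g l (lam k) (a k))
    (b := fun k x => g x (a k x)) (b₀ := fun x => g x (w x))
    (fun k => (hB (k + 1)).differentiable) (fun k => (hB (k + 1)).deriv_le)
    (fun k => (hB k).flow_lip hg) (fun k => (hB k).source_lip hg hl) hP.transport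
    (fun x => (tendsto_add_atTop_iff_nat 1).2 (hu x)) ?_ ?_ hx
  · exact (hg.contDiff.continuous.tendsto (x, w x)).comp (tendsto_const_nhds.prodMk_nhds (hw x))
  · simp only [source, hg.Dx_eq x (a _ x), hg.Dx_eq x (w x)]
    exact (((ContinuousLinearMap.adjoint (Dx g x 0)).continuous.tendsto (u x)).comp (hu x)).add
      (((contDiff_gradX hl.smooth).continuous.tendsto (x, w x)).comp
        (tendsto_const_nhds.prodMk_nhds (hw x)))

end PILambda

theorem corollary3p4 (d p : ℕ) (C : PILambda.Constants) (α : ℝ) (hα : 1 < α) (K : ℝ) (m : ℕ) :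
    ∃ ρ₂ : ℝ, ∀ ρ : ℝ, ρ₂ < ρ →
    ∀ (g : PILambda.E d → PILambda.E p → PILambda.E d) (l : PILambda.E d → PILambda.E p → ℝ),
    PILambda.AssumptionDynamics C g → PILambda.AssumptionCost C l →
    ∀ (lam : ℕ → PILambda.E d → PILambda.E d) (a : ℕ → PILambda.E d → PILambda.E p),
    PILambda.IsPILambda ρ g l m lam a →
    PILambda.LinearBounds K (lam 0) → PILambda.LinearBounds K (a 0) →
    ((d : ℝ) + 2 < 4 * α ∨
      (PILambda.sqNorm α (fun x => lam 1 x - lam 0 x) < ⊤ ∧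
        PILambda.sqNorm α (fun x => a 1 x - a 0 x) < ⊤)) →
    -- the iterates have an `L²_α` limit, which is a weak solution
    (∃ (mu : PILambda.E d → PILambda.E d) (b : PILambda.E d → PILambda.E p)
        (G : PILambda.E d → PILambda.E d →L[ℝ] PILambda.E d),
      Measurable mu ∧
      Tendsto (fun k => PILambda.sqNorm α (fun x => lam k x - mu x)) atTop (𝓝 0) ∧
      (PILambda.sqNorm α (lam 0) < ⊤ → PILambda.sqNorm α mu < ⊤) ∧
      PILambda.IsGreedy g l mu b ∧
      PILambda.IsWeakJacobian mu G ∧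
      PILambda.WeakIdentity ρ α g l mu b G) ∧
    -- if there is a classical solution, then the iterates converge to it
    (∀ (lamHat : PILambda.E d → PILambda.E d) (aHat : PILambda.E d → PILambda.E p),
      PILambda.IsClassicalSolution ρ g l lamHat aHat →
      (∀ x, ‖lamHat x‖ ≤ K * (1 + ‖x‖)) →
      Tendsto (fun k => PILambda.sqNorm α (fun x => lam k x - lamHat x)) atTop (𝓝 0) ∧
      PILambda.WeakIdentity ρ α g l lamHat aHat
        (fun x => ContinuousLinearMap.adjoint (fderiv ℝ lamHat x))) := by
  open PILambda in
  obtain ⟨ρ₂, hρ₂⟩ := exists_isLargeRate C K α d m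
  refine ⟨ρ₂, fun ρ hρ g l hg hl lam a hP h0 ha0 hor => ?_⟩
  have hL := hρ₂ ρ hρ
  have hα0 : 0 ≤ α := by linarith
  have hB := hP.uniformBounds hg hl hL h0 ha0
  obtain ⟨h1, h2⟩ : sqNorm α (fun x => lam 1 x - lam 0 x) < ⊤ ∧
      sqNorm α (fun x => a 1 x - a 0 x) < ⊤ := by
    rcases hor with h | h
    · exact ⟨sqNorm_lt_top_of_linear_growth h (M := 2 * stateBound K) fun x =>
        (norm_sub_le _ _).trans (by linarith [(hB 1).growth x, (hB 0).growth x]),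
        sqNorm_lt_top_of_linear_growth h (M := 2 * policyBound C K) fun x =>
        (norm_sub_le _ _).trans (by linarith [(hB 1).policy_growth x, (hB 0).policy_growth x])⟩
    · exact h
  constructor
  · obtain ⟨u, w, hu, hw, hgreedy⟩ := hP.exists_limit hg hl hL hB
    obtain ⟨hc, hJ, hW⟩ := hP.weak_solution (α := α) hg hl hB hu hw
    obtain ⟨hT, hfin⟩ := hP.tendsto_sqNorm hg hl hL hα0 hB h1 h2 hc.measurable hu
    exact ⟨u, w, _, hc.measurable, hT, hfin, hgreedy, hJ, hW⟩
  · intro u w h hK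
    have hud := h.smooth.differentiable one_ne_zero
    have hρ0 : ρ ≠ 0 := by
      have := hL.contraction
      have := flowBound_nonneg C K
      have := residualBound_pos C K
      exact (by linarith : 0 < ρ).ne'
    have hsym := h.adjoint_fderiv hg hl hρ0
    -- Symmetry turns the transposed system into the fixed-point equation of the iteration.
    have pde : ∀ x, ρ • u x = fderiv ℝ u x (g x (w x)) + source g l u w x := fun x => by
      rw [h.pde x, hsym, source, add_assoc]
    have hlim := hP.tendsto_of_isSolution hg hl hL hB hud (fun x => (hK x).trans (by
      gcongr
      unfold stateBound
      linarith [le_abs_self K])) h.greedy pde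
    refine ⟨(hP.tendsto_sqNorm hg hl hL hα0 hB h1 h2 hud.continuous.measurable hlim).1, ?_⟩
    refine weakIdentity_of_ae hg hl hud.continuous (continuous_iff_continuousAt.2 fun x =>
      (h.greedy.differentiableAt hg hl (hud x)).continuousAt) (Eventually.of_forall fun x => ?_)
    rw [hsym, pde x]
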